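/- **Setting.** Let $\Omega\subset\mathbb R^2$ be a bounded, simply connected, open polygonal domain (without slits, i.e. $\Omega$ is the interior of its closure). A pair of orthogonal staggered polygonal meshes of $\Omega$ consists of finitely many primary cells $A_i$ with centers $x_i\in\overline\Omega$, dual cells $A_\nu$ with centers $y_\nu\in\Omega$, and edge pairs $e$. The dual edge of $e$ is the segment joining the centers of the two primary cells in $CE(e)$ and has length $d_e$. The primary edge of $e$ is the segment joining the centers of the two dual cells in $VE(e)$ and has length $l_e$; if the dual edge lies on $\partial\Omega$, then $VE(e)$ consists of one dual cell and the primary edge is the segment from its center to the crossing point with the dual edge. The two edges of a pair are orthogonal and cross at a point inside both of them (for a boundary pair: inside the dual edge). The centers that belong to $e$ span a diamond $A_e$ (a triangle for a boundary pair); the diamonds cover $\overline\Omega$, do not overlap and meet face to face. Each cell is a polygon (with connected, nonempty interior), the union of the triangles spanned by its center and its edges; primary cells at the boundary are truncated to $\overline\Omega$, and every boundary edge of the mesh belongs to exactly one dual cell. $A_i,A_\nu,A_e$ also denote areas. $EC(i)$ and $EV(\nu)$ are the sets of $e$ with $i\in CE(e)$, respectively $\nu\in VE(e)$. For each $e$ choose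 a unit normal $\mathbf n_e$ to the primary edge and put $\mathbf t_e=\mathbf k\times\mathbf n_e$ (counterclockwise rotation by $\pi/2$). Let $n_{e,i}=1$ if $\mathbf n_e$ points away from $A_i$ and $-1$ if it points towards $A_i$, and let $t_{e,\nu}=1$ if $\mathbf t_e$ points away from $A_\nu$ and $-1$ if it points towards $A_\nu$. Let $\Phi_h=\{\varphi_h=\sum_i\varphi_i\chi_{A_i}\}$, $\Psi_h=\{\psi_h=\sum_\nu\psi_\nu\chi_{A_\nu}\}$ and $V_h=\{u_h=\sum_e u_e\chi_{A_e}\mathbf n_e\}$ with real coefficients, where $V_h$ carries the inner product $(u_h,v_h)_{0,h}=\sum_e A_eu_ev_e$. Elements are identified with their coefficients. Define $$[\nabla_h\varphi_h]_e=\frac{-1}{d_e}\sum_{i\in CE(e)}\varphi_in_{e,i},\qquad [\widetilde\nabla_h^\perp\psi_h]_e=\frac1{l_e}\sum_{\nu\in VE(e)}\psi_\nu t_{e,\nu},$$ $$[\nabla_h\cdot u_h]_i=\frac1{A_i}\sum_{e\in EC(i)}u_el_en_{e,i},\qquad [\widetilde\nabla_h\times u_h]_\nu=\frac{-1}{A_\nu}\sum_{e\in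 EV(\nu)}u_ed_et_{e,\nu}.$$ **Lemma (discrete Helmholtz decomposition).** The space $V_h$ is the orthogonal direct sum $$V_h=\{u_h\in V_h:\nabla_h\cdot u_h=0\}\oplus\{u_h\in V_h:\widetilde\nabla_h\times u_h=0\}.$$ Every $\widetilde\nabla_h^\perp\psi_h$ with $\psi_h\in\Psi_h$ lies in the first summand and every $\nabla_h\varphi_h$ with $\varphi_h\in\Phi_h$ in the second. For every $u_h\in V_h$ there is exactly one pair $(\psi_h,\varphi_h)\in\Psi_h\times\Phi_h$ with $\sum_iA_i\varphi_i=0$ and $$u_h=\widetilde\nabla_h^\perp\psi_h+\nabla_h\varphi_h.$$ -/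

import Mathlib

open scoped BigOperators

noncomputable section

/-- The Euclidean plane. -/
abbrev Plane : Type := EuclideanSpace ℝ (Fin 2)

/-- Rotation by a right angle counterclockwise, `v ↦ k × v` with `k` the upward unit vector. -/
def rotate90 (v : Plane) : Plane := !₂[-(v 1), v 0]

/-- A pair of orthogonal staggered polygonal meshes of a plane domain `Ω`, with `nc` primary cells,
`nv` dual cells and `ne` edge pairs (each count includes the boundary ones).

The primary edge of the pair `e` joins the centers of the dual cells in `VE e`, and its dual edge
joins the centers of the primary cells in `CE e`. The two cross at right angles at the point
`cross e`, inside both edges. If the dual edge lies on the boundary of `Ω`, only one dual cell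
borders `e`, and the primary edge is cut off at its crossing point with the boundary. The diamond of
`e` is spanned by the (two or one) dual centers and the two primary centers that belong to `e`. -/
structure StaggeredMesh (Ω : Set Plane) (nc nv ne : ℕ) where
  /-- centers of the primary cells -/
  x : Fin nc → Plane
  /-- centers of the dual cells -/
  y : Fin nv → Plane
  /-- the primary cells that border an edge -/
  CE : Fin ne → Finset (Fin nc)
  /-- the dual cells that border an edge -/
  VE : Fin ne → Finset (Fin nv)
  /-- the intersection point of the primary and the dual edge -/
  cross : Fin ne → Plane
  /-- the chosen unit normal to the primary edge -/
  normal : Fin ne → Plane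
  card_CE : ∀ e, (CE e).card = 2
  card_VE : ∀ e, (VE e).card = 1 ∨ (VE e).card = 2
  x_ne_cross : ∀ e, ∀ i ∈ CE e, x i ≠ cross e
  y_ne_cross : ∀ e, ∀ ν ∈ VE e, y ν ≠ cross e
  cross_mem_dual : ∀ e, ∀ i ∈ CE e, ∀ j ∈ CE e, i ≠ j → cross e ∈ openSegment ℝ (x i) (x j)
  cross_mem_primary : ∀ e, ∀ ν ∈ VE e, ∀ μ ∈ VE e, ν ≠ μ → cross e ∈ openSegment ℝ (y ν) (y μ)
  orthogonal : ∀ e, ∀ i ∈ CE e, ∀ ν ∈ VE e, inner ℝ (x i - cross e) (y ν - cross e) = 0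
  norm_normal : ∀ e, ‖normal e‖ = 1
  normal_orthogonal : ∀ e, ∀ ν ∈ VE e, inner ℝ (normal e) (y ν - cross e) = 0
  /-- The dual cells, with their centers, lie inside the domain. -/
  y_mem : ∀ ν, y ν ∈ Ω
  /-- An edge that borders one dual cell only has its dual edge on the boundary. -/
  boundary : ∀ e, (VE e).card = 1 → convexHull ℝ (x '' CE e) ⊆ frontier Ω
  /-- The diamonds cover the domain. -/
  cover : ⋃ e, convexHull ℝ (x '' CE e ∪ y '' VE e) = closure Ω
  /-- The diamonds do not overlap. -/
  nonoverlapping : ∀ e e', e ≠ e' →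
    Disjoint (interior (convexHull ℝ (x '' CE e ∪ y '' VE e)))
      (interior (convexHull ℝ (x '' CE e' ∪ y '' VE e')))
  /-- The diamonds meet face to face (there are no hanging vertices). -/
  conforming : ∀ e e', e ≠ e' →
    convexHull ℝ (x '' CE e ∪ y '' VE e) ∩ convexHull ℝ (x '' CE e' ∪ y '' VE e') ⊆
      convexHull ℝ (x '' (CE e ∩ CE e' : Finset (Fin nc)) ∪ y '' (VE e ∩ VE e' : Finset (Fin nv)))
  /-- The primary cells are polygons, hence have a connected, nonempty interior.
  Such a cell is the union of the triangles spanned by its center and its edges. -/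
  cell_connected : ∀ i, IsConnected (interior
    (⋃ e, ⋃ _ : i ∈ CE e, convexHull ℝ (insert (x i) (insert (cross e) (y '' VE e)))))
  /-- The dual cells are polygons, hence have a connected, nonempty interior.
  Such a cell is the union of the triangles spanned by its center and its edges. -/
  dualCell_connected : ∀ ν, IsConnected (interior
    (⋃ e, ⋃ _ : ν ∈ VE e, convexHull ℝ (insert (y ν) (x '' CE e))))

namespace StaggeredMesh

variable {Ω : Set Plane} {nc nv ne : ℕ} (M : StaggeredMesh Ω nc nv ne)

/-- The primary edge `e`; at the boundary, the part of it inside the domain. -/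
def primaryEdge (e : Fin ne) : Set Plane := convexHull ℝ (insert (M.cross e) (M.y '' M.VE e))

/-- The dual edge `e`. -/
def dualEdge (e : Fin ne) : Set Plane := convexHull ℝ (M.x '' M.CE e)

/-- The diamond `A_e` (at the boundary, the triangle inside the domain). -/
def diamond (e : Fin ne) : Set Plane := convexHull ℝ (M.x '' M.CE e ∪ M.y '' M.VE e)

/-- The edges of the primary cell `i`. -/
def EC (i : Fin nc) : Finset (Fin ne) := {e | i ∈ M.CE e}

/-- The edges of the dual cell `ν`. -/
def EV (ν : Fin nv) : Finset (Fin ne) := {e | ν ∈ M.VE e}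

/-- The primary cell `A_i` (at the boundary, its part inside the domain): the union of the
triangles spanned by its center and its edges. -/
def cell (i : Fin nc) : Set Plane :=
  ⋃ e ∈ M.EC i, convexHull ℝ (insert (M.x i) (M.primaryEdge e))

/-- The dual cell `A_ν`: the union of the triangles spanned by its center and its edges. -/
def dualCell (ν : Fin nv) : Set Plane :=
  ⋃ e ∈ M.EV ν, convexHull ℝ (insert (M.y ν) (M.dualEdge e))

/-- The length `l_e` of the primary edge. -/
def l (e : Fin ne) : ℝ := Metric.diam (M.primaryEdge e)

/-- The length `d_e` of the dual edge. -/
def d (e : Fin ne) : ℝ := Metric.diam (M.dualEdge e)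

/-- The area of a primary cell. -/
def cellArea (i : Fin nc) : ℝ := MeasureTheory.volume.real (M.cell i)

/-- The area of a dual cell. -/
def dualCellArea (ν : Fin nv) : ℝ := MeasureTheory.volume.real (M.dualCell ν)

/-- The area of a diamond. -/
def diamondArea (e : Fin ne) : ℝ := MeasureTheory.volume.real (M.diamond e)

/-- The unit tangent `t_e = k × n_e` of the primary edge. -/
def tangent (e : Fin ne) : Plane := rotate90 (M.normal e)

/-- The indicator `n_{e,i}`, for `i ∈ CE e`: `1` if the unit normal `n_e` points away from the
primary cell `i`, and `-1` if it points towards it. -/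
def nSign (e : Fin ne) (i : Fin nc) : ℝ :=
  if 0 < inner ℝ (M.normal e) (M.cross e - M.x i) then 1 else -1

/-- The indicator `t_{e,ν}`, for `ν ∈ VE e`: `1` if the unit tangent `t_e` points away from the
dual cell `ν`, and `-1` if it points towards it. -/
def tSign (e : Fin ne) (ν : Fin nv) : ℝ :=
  if 0 < inner ℝ (M.tangent e) (M.cross e - M.y ν) then 1 else -1

/-- Discrete scalar fields `φ_h = ∑ φ_i χ_i` on the primary mesh, given by their values `φ_i`. -/
abbrev PrimaryField (_ : StaggeredMesh Ω nc nv ne) : Type := Fin nc → ℝ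

/-- Discrete scalar fields `ψ_h = ∑ ψ_ν χ_ν` on the dual mesh, given by their values `ψ_ν`. -/
abbrev DualField (_ : StaggeredMesh Ω nc nv ne) : Type := Fin nv → ℝ

/-- The space `V_h` of edge-normal discrete vector fields `u_h = ∑ u_e χ_e n_e`, where `χ_e` is the
indicator function of the diamond `A_e`; such a field is given by its normal components `u_e`. -/
abbrev VectorField (_ : StaggeredMesh Ω nc nv ne) : Type := Fin ne → ℝ

/-- The discrete `L²` inner product of `V_h`. -/
def innerV (u v : M.VectorField) : ℝ := ∑ e, M.diamondArea e * u e * v e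

/-- The discrete gradient. -/
def grad : M.PrimaryField →ₗ[ℝ] M.VectorField where
  toFun φ := fun e => (-1 / M.d e) * ∑ i ∈ M.CE e, φ i * M.nSign e i
  map_add' φ φ' := by
    ext e; simp only [Pi.add_apply, add_mul, Finset.sum_add_distrib, mul_add]
  map_smul' c φ := by
    ext e
    simp only [Pi.smul_apply, smul_eq_mul, RingHom.id_apply, mul_assoc, ← Finset.mul_sum]
    ring

/-- The discrete skewed gradient. -/
def skewGrad : M.DualField →ₗ[ℝ] M.VectorField where
  toFun ψ := fun e => (1 / M.l e) * ∑ ν ∈ M.VE e, ψ ν * M.tSign e ν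
  map_add' ψ ψ' := by
    ext e; simp only [Pi.add_apply, add_mul, Finset.sum_add_distrib, mul_add]
  map_smul' c ψ := by
    ext e
    simp only [Pi.smul_apply, smul_eq_mul, RingHom.id_apply, mul_assoc, ← Finset.mul_sum]
    ring

/-- The discrete divergence. -/
def div : M.VectorField →ₗ[ℝ] M.PrimaryField where
  toFun u := fun i => (1 / M.cellArea i) * ∑ e ∈ M.EC i, u e * M.l e * M.nSign e i
  map_add' u u' := by
    ext i; simp only [Pi.add_apply, add_mul, Finset.sum_add_distrib, mul_add]
  map_smul' c u := by
    ext i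
    simp only [Pi.smul_apply, smul_eq_mul, RingHom.id_apply, mul_assoc, ← Finset.mul_sum]
    ring

/-- The discrete curl. -/
def curl : M.VectorField →ₗ[ℝ] M.DualField where
  toFun u := fun ν => (-1 / M.dualCellArea ν) * ∑ e ∈ M.EV ν, u e * M.d e * M.tSign e ν
  map_add' u u' := by
    ext ν; simp only [Pi.add_apply, add_mul, Finset.sum_add_distrib, mul_add]
  map_smul' c u := by
    ext ν
    simp only [Pi.smul_apply, smul_eq_mul, RingHom.id_apply, mul_assoc, ← Finset.mul_sum]
    ring

end StaggeredMesh

end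

/-!
The proof has an algebraic part, in which the discrete operators behave like the de Rham complex of
the plane, and a topological part, in which the simple connectedness of `Ω` makes this complex exact.

*Algebra.* The area of a diamond is a fixed multiple of `l e * d e`, because its diagonals are
orthogonal. Hence, up to this constant, `skewGrad` is minus the adjoint of `curl` and `grad` is minus
the adjoint of `div` (`innerV_skewGrad`, `innerV_grad`). The segment from a primary center to a dual
center is a side of no diamond or of exactly two, one on each side, since dual centers lie inside
`Ω` (`exists_adjacent`, `planeDet_mul_planeDet_neg`); the orientation signs of the two cancel
(`sum_nSign_mul_tSign`). So skewed gradients are divergence-free and gradients are curl-free.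

*Kernels.* Diamonds that meet at a point of `Ω` have a primary center in common, unless the point is
a dual center, and a dual center in common, unless it is a primary center (`exists_common_x`,
`exists_common_y`). As `Ω` stays connected when finitely many points are removed, `grad` vanishes on
constants only and `skewGrad` is injective; for the latter a boundary edge is needed
(`exists_card_VE_eq_one`). These incidence facts rest on one tool: two different diamonds
are separated by a line (`exists_separating`).

*Exactness.* If `curl u = 0`, then `u` is a gradient around each dual center
(`exists_localPotential`). The open stars of all the centers cover `Ω`
(`exists_common_center`), `u` has a potential on each star, and two of these differ by a locally
constant function. They define a covering space of `Ω` with fibre `ℝ`, and a section of it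
(`exists_sub_locallyConst_of_simplyConnected`) adjusts the local potentials so that they agree in
every diamond. Around a primary center, the diamonds are linked through dual centers because the
primary cell has connected interior (`eq_of_mem_EC`), so the values there agree as well and `u` is a
global gradient (`exists_grad_eq`).

*Conclusion.* By exactness and adjointness, the two kernels are orthogonal. The map `curl ∘ skewGrad`
is injective by adjointness, hence bijective, so every `u` differs from a skewed gradient by a
curl-free field, that is, by a gradient. Uniqueness follows from orthogonality and the kernels.
-/

noncomputable section

/-! ### The plane -/

/-- The determinant of two plane vectors. -/
def planeDet (a b : Plane) : ℝ := a 0 * b 1 - a 1 * b 0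

lemma plane_inner_eq (a b : Plane) : inner ℝ a b = a 0 * b 0 + a 1 * b 1 := by
  simp [PiLp.inner_apply, Fin.sum_univ_two]; ring

/-- Cramer's rule for plane vectors. -/
lemma planeDet_smul (a b v : Plane) :
    planeDet a b • v = planeDet v b • a + planeDet a v • b := by
  ext k; fin_cases k <;> simp [planeDet] <;> ring

lemma planeDet_sq_add_inner_sq (a b : Plane) :
    planeDet a b ^ 2 + (inner ℝ a b) ^ 2 = inner ℝ a a * inner ℝ b b := by
  simp only [planeDet, plane_inner_eq]; ring

lemma abs_planeDet_of_inner_eq_zero {a b : Plane} (h : inner ℝ a b = 0) :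
    |planeDet a b| = ‖a‖ * ‖b‖ := by
  have := planeDet_sq_add_inner_sq a b
  rw [h, real_inner_self_eq_norm_sq, real_inner_self_eq_norm_sq] at this
  rw [← abs_of_nonneg (mul_nonneg (norm_nonneg a) (norm_nonneg b)), ← sq_eq_sq_iff_abs_eq_abs]
  linarith

lemma planeDet_ne_zero_of_inner_eq_zero {a b : Plane} (ha : a ≠ 0) (hb : b ≠ 0)
    (h : inner ℝ a b = 0) : planeDet a b ≠ 0 := by
  rw [← abs_pos, abs_planeDet_of_inner_eq_zero h]
  exact mul_pos (norm_pos_iff.2 ha) (norm_pos_iff.2 hb)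

lemma StrongDual.eq_zero_of_planeDet_ne_zero {f : StrongDual ℝ Plane} {a b : Plane}
    (h : planeDet a b ≠ 0) (ha : f a = 0) (hb : f b = 0) : f = 0 := by
  ext v
  have := congrArg f (planeDet_smul a b v)
  simp only [map_smul, map_add, ha, hb, smul_eq_mul, mul_zero, add_zero] at this
  simpa [h] using this

lemma one_lt_rank_plane : 1 < Module.rank ℝ Plane := by
  rw [← Module.finrank_eq_rank]; simp

/-! ### Areas of triangles -/

/-- The triangle spanned by the origin and the two unit coordinate vectors. -/
def stdTriangle : Set Plane := convexHull ℝ {0, !₂[1, 0], !₂[0, 1]}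

/-- The area of the standard triangle. Only its positivity matters. -/
def stdArea : ℝ := MeasureTheory.volume.real stdTriangle

lemma Bornology.IsBounded.convexHull_of_finite {s : Set Plane} (hs : s.Finite) :
    Bornology.IsBounded (convexHull ℝ s) :=
  (isBounded_convexHull).2 hs.isBounded

lemma volume_convexHull_ne_top {s : Set Plane} (hs : s.Finite) :
    MeasureTheory.volume (convexHull ℝ s) ≠ ⊤ :=
  (Bornology.IsBounded.convexHull_of_finite hs).measure_lt_top.ne

lemma stdArea_pos : 0 < stdArea := by
  have hsub : {p : Plane | 0 < p 0 ∧ 0 < p 1 ∧ p 0 + p 1 < 1} ⊆ stdTriangle := by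
    rintro p ⟨h0, h1, h2⟩
    have hc : Convex ℝ stdTriangle := convex_convexHull _ _
    have m : ∀ q ∈ ({0, !₂[1, 0], !₂[0, 1]} : Set Plane), q ∈ stdTriangle :=
      fun q hq => subset_convexHull _ _ hq
    have := hc.sum_mem (t := Finset.univ) (w := ![1 - p 0 - p 1, p 0, p 1])
      (z := ![0, !₂[1, 0], !₂[0, 1]])
      (by intro i _; fin_cases i <;> simp <;> linarith)
      (by simp [Fin.sum_univ_three]; ring) (by intro i _; fin_cases i <;> apply m <;> simp)
    convert this using 1
    ext k; fin_cases k <;> simp [Fin.sum_univ_three]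
  have hopen : IsOpen {p : Plane | 0 < p 0 ∧ 0 < p 1 ∧ p 0 + p 1 < 1} := by
    have c0 : Continuous fun p : Plane => p 0 := by fun_prop
    have c1 : Continuous fun p : Plane => p 1 := by fun_prop
    exact (isOpen_lt continuous_const c0).inter
      ((isOpen_lt continuous_const c1).inter (isOpen_lt (c0.add c1) continuous_const))
  have hne : {p : Plane | 0 < p 0 ∧ 0 < p 1 ∧ p 0 + p 1 < 1}.Nonempty :=
    ⟨!₂[1/4, 1/4], by norm_num⟩
  refine ENNReal.toReal_pos ?_ (volume_convexHull_ne_top (by simp))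
  exact ((hopen.measure_pos MeasureTheory.volume hne).trans_le
    (MeasureTheory.measure_mono hsub)).ne'

open Pointwise in
/-- The area of a triangle is proportional to the determinant of two of its sides. -/
lemma volume_triangle (a b c : Plane) :
    MeasureTheory.volume.real (convexHull ℝ {a, b, c})
      = stdArea * |planeDet (b - a) (c - a)| := by
  set L : Plane →ₗ[ℝ] Plane :=
    Matrix.toLin (EuclideanSpace.basisFun (Fin 2) ℝ).toBasis
      (EuclideanSpace.basisFun (Fin 2) ℝ).toBasis
      !![(b - a) 0, (c - a) 0; (b - a) 1, (c - a) 1] with hL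
  have hdet : LinearMap.det L = planeDet (b - a) (c - a) := by
    rw [hL, LinearMap.det_toLin, Matrix.det_fin_two_of, planeDet]; ring
  have hLe (p : Plane) : L p = p 0 • (b - a) + p 1 • (c - a) := by
    rw [hL]
    ext k
    simp only [Matrix.toLin_apply, Matrix.mulVec, dotProduct, Fin.sum_univ_two]
    fin_cases k <;> simp <;> ring
  have himg : convexHull ℝ {a, b, c} = a +ᵥ (L '' stdTriangle) := by
    rw [stdTriangle, LinearMap.image_convexHull, ← convexHull_vadd]
    congr 1
    simp [Set.image_insert_eq, hLe, ← Set.image_vadd]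
  rw [himg, MeasureTheory.measureReal_def, MeasureTheory.measure_vadd,
    MeasureTheory.Measure.addHaar_image_linearMap, ENNReal.toReal_mul,
    ENNReal.toReal_ofReal (abs_nonneg _), hdet, mul_comm]
  rfl

lemma Convex.interior_nonempty_of_volume_ne_zero {s : Set Plane} (hs : Convex ℝ s)
    (h : MeasureTheory.volume.real s ≠ 0) : (interior s).Nonempty := by
  by_contra hne
  rw [Set.not_nonempty_iff_eq_empty] at hne
  apply h
  have h0 : MeasureTheory.volume s ≤ 0 := by
    rw [← hs.addHaar_frontier MeasureTheory.volume]
    refine (MeasureTheory.measure_mono subset_closure).trans_eq ?_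
    rw [frontier, hne, Set.sdiff_empty]
  rw [MeasureTheory.measureReal_def, le_zero_iff.1 h0, ENNReal.toReal_zero]

lemma interior_triangle_nonempty {a b c : Plane} (h : planeDet (b - a) (c - a) ≠ 0) :
    (interior (convexHull ℝ {a, b, c})).Nonempty := by
  apply (convex_convexHull ℝ _).interior_nonempty_of_volume_ne_zero
  rw [volume_triangle]
  exact mul_ne_zero stdArea_pos.ne' (abs_ne_zero.2 h)

/-- A nonzero linear functional has no maximum in the interior of a set. -/
lemma StrongDual.eq_zero_of_isMax_interior {f : StrongDual ℝ Plane} {γ : ℝ} {s : Set Plane}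
    {z : Plane} (hz : z ∈ interior s) (hf : ∀ p ∈ s, f p ≤ γ) (hfz : f z = γ) : f = 0 := by
  have key : ∀ v, f v ≤ 0 := by
    intro v
    have hc : Continuous fun t : ℝ => z + t • v := by fun_prop
    have hev : ∀ᶠ t in nhds (0 : ℝ), z + t • v ∈ interior s :=
      hc.continuousAt.eventually (isOpen_interior.mem_nhds (by simpa using hz))
    obtain ⟨ε, hε, h⟩ := Metric.eventually_nhds_iff.1 hev
    have := hf _ (interior_subset (h (y := ε / 2) (by
      rw [Real.dist_eq, sub_zero, abs_of_pos (by positivity)]; linarith)))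
    rw [map_add, map_smul, smul_eq_mul, hfz] at this
    nlinarith
  ext v
  have h1 := key v
  have h2 := key (-v)
  rw [map_neg] at h2
  simp only [_root_.zero_apply]
  linarith

/-! ### Connectedness -/

/-- Removing countably many points from a ball of the plane leaves a preconnected set. -/
lemma isPreconnected_ball_diff_countable (z : Plane) {r : ℝ} (hr : 0 < r) {F : Set Plane}
    (hF : F.Countable) : IsPreconnected (Metric.ball z r \ F) := by
  set h := OpenPartialHomeomorph.univBall z r with hh
  have hsrc : h.source = Set.univ := OpenPartialHomeomorph.univBall_source z r
  have htgt : h.target = Metric.ball z r := OpenPartialHomeomorph.univBall_target z hr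
  have hinj : Function.Injective h := by
    have := h.injOn; rw [hsrc] at this; exact Set.injOn_univ.1 this
  have himg : Metric.ball z r \ F = h '' (h ⁻¹' F)ᶜ := by
    rw [← Set.preimage_compl, Set.image_preimage_eq_inter_range, ← Set.image_univ, ← hsrc,
      h.image_source_eq_target, htgt, Set.inter_comm, Set.sdiff_eq]
  rw [himg]
  exact ((hF.preimage hinj).isConnected_compl_of_one_lt_rank one_lt_rank_plane).isPreconnected.image
    _ (OpenPartialHomeomorph.continuous_univBall z r).continuousOn

lemma IsOpen.nonempty_diff_countable {U F : Set Plane} (hU : IsOpen U) (hne : U.Nonempty)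
    (hF : F.Countable) : (U \ F).Nonempty := by
  obtain ⟨z, hz, hz'⟩ := (hF.dense_compl ℝ).inter_open_nonempty U hU hne
  exact ⟨z, hz, hz'⟩

/-- A connected open set of the plane stays connected when countably many points are removed. -/
lemma IsPreconnected.diff_countable {U F : Set Plane} (hU : IsOpen U) (hUc : IsPreconnected U)
    (hF : F.Countable) : IsPreconnected (U \ F) := by
  intro u v hu hv hsub hun hvn
  by_contra hcon
  -- the points near which `U \ F` lies in `w`
  let A : Set Plane → Set Plane := fun w =>
    {z | ∃ r > 0, Metric.ball z r ⊆ U ∧ Metric.ball z r \ F ⊆ w}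
  have hAopen (w : Set Plane) : IsOpen (A w) := by
    rw [Metric.isOpen_iff]
    rintro z ⟨r, hr, h1, h2⟩
    refine ⟨r, hr, fun y hy => ⟨r - dist y z, by simpa using hy, ?_, ?_⟩⟩
    · exact (Metric.ball_subset_ball' (by linarith)).trans h1
    · exact (Set.sdiff_subset_sdiff_left (Metric.ball_subset_ball' (by linarith))).trans h2
  have hAmem {w : Set Plane} (hw : IsOpen w) {z : Plane} (hzU : z ∈ U) (hzw : z ∈ w) : z ∈ A w := by
    obtain ⟨r, hr, h⟩ := Metric.isOpen_iff.1 (hU.inter hw) z ⟨hzU, hzw⟩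
    exact ⟨r, hr, h.trans Set.inter_subset_left,
      Set.sdiff_subset.trans (h.trans Set.inter_subset_right)⟩
  have hcov : U ⊆ A u ∪ A v := by
    intro z hz
    obtain ⟨r, hr, h⟩ := Metric.isOpen_iff.1 hU z hz
    have hpre := isPreconnected_ball_diff_countable z hr hF
    have hsub' : Metric.ball z r \ F ⊆ u ∪ v := (Set.sdiff_subset_sdiff_left h).trans hsub
    by_contra hneg
    simp only [Set.mem_union, not_or] at hneg
    have hu' : ((Metric.ball z r \ F) ∩ u).Nonempty := by
      by_contra hn
      refine hneg.2 ⟨r, hr, h, fun p hp => (hsub' hp).resolve_left fun hpu => hn ⟨p, hp, hpu⟩⟩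
    have hv' : ((Metric.ball z r \ F) ∩ v).Nonempty := by
      by_contra hn
      refine hneg.1 ⟨r, hr, h, fun p hp => (hsub' hp).resolve_right fun hpu => hn ⟨p, hp, hpu⟩⟩
    obtain ⟨p, hp, hp'⟩ := hpre u v hu hv hsub' hu' hv'
    exact hcon ⟨p, ⟨h hp.1, hp.2⟩, hp'⟩
  obtain ⟨p, hp, hpu⟩ := hun
  obtain ⟨q, hq, hqv⟩ := hvn
  obtain ⟨z, hz, ⟨r, hr, h1, h2⟩, ⟨r', hr', h1', h2'⟩⟩ := hUc _ _ (hAopen u) (hAopen v) hcov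
    ⟨p, hp.1, hAmem hu hp.1 hpu⟩ ⟨q, hq.1, hAmem hv hq.1 hqv⟩
  obtain ⟨t, ht, htF⟩ := (Metric.isOpen_ball (x := z) (ε := min r r')).nonempty_diff_countable
    ⟨z, by simp [hr, hr']⟩ hF
  have htr : t ∈ Metric.ball z r := Metric.ball_subset_ball (min_le_left _ _) ht
  have htr' : t ∈ Metric.ball z r' := Metric.ball_subset_ball (min_le_right _ _) ht
  exact hcon ⟨t, ⟨h1 htr, htF⟩, h2 ⟨htr, htF⟩, h2' ⟨htr', htF⟩⟩

/-- If a connected set `S` is covered by finitely many closed sets, then a colouring of these sets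
in which any two sets that meet inside `S` have the same colour is constant on the sets
that meet `S`. -/
lemma IsPreconnected.colour_eq {X ι α : Type*} [TopologicalSpace X] [Finite ι] {S : Set X}
    (hS : IsPreconnected S) (C : ι → Set X) (hC : ∀ e, IsClosed (C e)) (T : Set ι)
    (hcov : ∀ z ∈ S, ∃ e ∈ T, z ∈ C e) (s : ι → α)
    (hs : ∀ e ∈ T, ∀ e' ∈ T, ∀ z ∈ S, z ∈ C e → z ∈ C e' → s e = s e') {e e' : ι} (he : e ∈ T)
    (he' : e' ∈ T) (hSe : (S ∩ C e).Nonempty) (hSe' : (S ∩ C e').Nonempty) : s e = s e' := by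
  by_contra hne
  have hcl (P : ι → Prop) : IsClosed (⋃ a, ⋃ _ : P a, C a) := by
    exact (Set.toFinite {a | P a}).isClosed_biUnion fun a _ => hC a
  obtain ⟨z, hz, h1, h2⟩ := isPreconnected_closed_iff.1 hS
    (⋃ a, ⋃ _ : a ∈ T ∧ s a = s e, C a) (⋃ a, ⋃ _ : a ∈ T ∧ s a ≠ s e, C a) (hcl _) (hcl _)
    (fun z hz => by
      obtain ⟨a, ha, hza⟩ := hcov z hz
      simp only [Set.mem_union, Set.mem_iUnion]
      by_cases h : s a = s e
      · exact Or.inl ⟨a, ⟨ha, h⟩, hza⟩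
      · exact Or.inr ⟨a, ⟨ha, h⟩, hza⟩)
    (hSe.mono (Set.inter_subset_inter_right _ (Set.subset_iUnion₂_of_subset e ⟨he, rfl⟩ subset_rfl)))
    (hSe'.mono (Set.inter_subset_inter_right _
      (Set.subset_iUnion₂_of_subset e' ⟨he', Ne.symm hne⟩ subset_rfl)))
  simp only [Set.mem_iUnion] at h1 h2
  obtain ⟨a, ⟨ha, has⟩, hza⟩ := h1
  obtain ⟨b, ⟨hb, hbs⟩, hzb⟩ := h2
  exact hbs ((hs b hb a ha z hz hzb hza).trans has)

/-! ### Locally constant cocycles on a simply connected space -/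

open Topology in
/-- On a simply connected space, functions on the members of an open cover whose differences are
locally constant on the overlaps differ by locally constant functions from one global
function. -/
lemma exists_sub_locallyConst_of_simplyConnected {X ι G : Type*} [TopologicalSpace X]
    [SimplyConnectedSpace X] [LocallyPathConnectedSpace X] [AddCommGroup G] (U : ι → Set X)
    (hU : ∀ a, IsOpen (U a)) (hcov : ∀ z, ∃ a, z ∈ U a) (f : ι → X → G)
    (hf : ∀ a b, ∀ z ∈ U a ∩ U b, ∀ᶠ w in 𝓝 z, f a w - f b w = f a z - f b z) :
    ∃ F : X → G, ∀ a, ∀ z ∈ U a, ∀ᶠ w in 𝓝 z, F w - f a w = F z - f a z := by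
  let _ : TopologicalSpace G := ⊥
  have : DiscreteTopology G := ⟨rfl⟩
  choose idx hidx using hcov
  -- The covering space with fibre `G`; the coordinate in the chart `a` of the point over `x`
  -- that stands for the value `v` of a global function is `v - f a x`.
  let Z : FiberBundleCore ι X G :=
    { baseSet := U
      isOpen_baseSet := hU
      indexAt := idx
      mem_baseSet_at := hidx
      coordChange := fun a b x v => v + (f a x - f b x)
      coordChange_self := fun a x _ v => by simp
      continuousOn_coordChange := fun a b => by
        rintro ⟨z, v⟩ ⟨hz, -⟩
        apply ContinuousAt.continuousWithinAt
        rw [ContinuousAt, nhds_discrete G, Filter.tendsto_pure, nhds_prod_eq, nhds_discrete G]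
        filter_upwards [Filter.prod_mem_prod (hf a b z hz) (Filter.mem_pure.2 (Set.mem_singleton v))]
          with p hp
        obtain ⟨hp1, hp2⟩ := hp
        rw [Set.mem_singleton_iff.1 hp2]
        exact congrArg (v + ·) hp1
      coordChange_comp := fun a b c x _ v => by abel }
  have hcm : IsCoveringMap (Bundle.TotalSpace.proj : Z.TotalSpace → X) :=
    FiberBundle.isCoveringMap (F := G) (E := Z.Fiber)
  obtain ⟨x₀⟩ : Nonempty X := inferInstance
  obtain ⟨s, ⟨-, hs⟩, -⟩ := hcm.existsUnique_continuousMap_lifts (ContinuousMap.id X) x₀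
    (⟨x₀, (0 : G)⟩ : Z.TotalSpace) rfl
  have hsp (x : X) : (s x).proj = x := congrFun hs x
  let val : Z.TotalSpace → G := fun p => p.2
  refine ⟨fun x => val (s x) + f (idx x) x, fun a z hz => ?_⟩
  -- in the chart `a` the section is continuous, hence locally constant
  have hmem : s z ∈ (Z.localTriv a).source := by
    rw [Bundle.Trivialization.mem_source]
    change (s z).proj ∈ U a
    rwa [hsp]
  have hcont : ContinuousAt (fun x => (Z.localTriv a (s x)).2) z :=
    continuous_snd.continuousAt.comp
      (((Z.localTriv a).continuousAt hmem).comp s.continuous.continuousAt)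
  rw [ContinuousAt, nhds_discrete G, Filter.tendsto_pure] at hcont
  have hval (x : X) : (Z.localTriv a (s x)).2 = val (s x) + (f (idx x) x - f a x) := by
    change val (s x) + (f (idx (s x).proj) (s x).proj - f a (s x).proj) = _
    rw [hsp]
  filter_upwards [hcont] with w hw
  rw [hval, hval] at hw
  simpa only [add_sub_assoc] using hw

/-! ### Diamonds -/

lemma StrongDual.le_of_mem_convexHull {s : Set Plane} {f : StrongDual ℝ Plane} {γ : ℝ}
    (h : ∀ p ∈ s, f p ≤ γ) : ∀ p ∈ convexHull ℝ s, f p ≤ γ :=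
  fun _ hp => convexHull_min (t := {p | f p ≤ γ}) h
    (convex_halfSpace_le f.toLinearMap.isLinear γ) hp

lemma inner_le_zero_of_mem_convexHull {s : Set Plane} {a c : Plane}
    (h : ∀ p ∈ s, inner ℝ (p - c) a ≤ 0) : ∀ p ∈ convexHull ℝ s, inner ℝ (p - c) a ≤ 0 := by
  intro p hp
  have := StrongDual.le_of_mem_convexHull (f := innerSL ℝ a) (γ := innerSL ℝ a c) (s := s)
    (fun q hq => by
      have := h q hq
      rw [real_inner_comm, inner_sub_right] at this
      simpa using this) p hp
  rw [real_inner_comm, inner_sub_right]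
  simpa using this

lemma exists_sub_eq_neg_smul_of_mem_openSegment {a b c : Plane} (h : c ∈ openSegment ℝ a b) :
    ∃ τ : ℝ, 0 < τ ∧ b - c = -(τ • (a - c)) := by
  obtain ⟨s, t, hs, ht, hst, rfl⟩ := h
  refine ⟨s / t, by positivity, ?_⟩
  have hs' : s = 1 - t := by linarith
  subst hs'
  ext k
  simp only [PiLp.sub_apply, PiLp.add_apply, PiLp.smul_apply, smul_eq_mul, PiLp.neg_apply]
  field_simp
  ring

namespace StaggeredMesh

variable {Ω : Set Plane} {nc nv ne : ℕ} (M : StaggeredMesh Ω nc nv ne)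

lemma mem_EC {i : Fin nc} {e : Fin ne} : e ∈ M.EC i ↔ i ∈ M.CE e := by simp [EC]

lemma mem_EV {ν : Fin nv} {e : Fin ne} : e ∈ M.EV ν ↔ ν ∈ M.VE e := by simp [EV]

lemma CE_nonempty (e : Fin ne) : (M.CE e).Nonempty :=
  Finset.card_pos.1 (by rw [M.card_CE e]; norm_num)

lemma VE_nonempty (e : Fin ne) : (M.VE e).Nonempty :=
  Finset.card_pos.1 (by rcases M.card_VE e with h | h <;> rw [h] <;> norm_num)

/-- The other primary center of an edge lies opposite the given one, as seen from the crossing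
point. -/
lemma exists_opposite_x {e : Fin ne} {i : Fin nc} (hi : i ∈ M.CE e) :
    ∃ j ∈ M.CE e, j ≠ i ∧ M.CE e = {i, j} ∧ M.cross e ∈ openSegment ℝ (M.x i) (M.x j) ∧
      ∃ τ : ℝ, 0 < τ ∧ M.x j - M.cross e = -(τ • (M.x i - M.cross e)) := by
  obtain ⟨a, b, hab, h⟩ := Finset.card_eq_two.1 (M.card_CE e)
  have key : ∀ j ∈ M.CE e, j ≠ i → M.cross e ∈ openSegment ℝ (M.x i) (M.x j) :=
    fun j hj hne => M.cross_mem_dual e i hi j hj hne.symm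
  have hi' := hi
  rw [h, Finset.mem_insert, Finset.mem_singleton] at hi'
  rcases hi' with rfl | rfl
  · have hb : b ∈ M.CE e := by simp [h]
    exact ⟨b, hb, hab.symm, h, key b hb hab.symm,
      exists_sub_eq_neg_smul_of_mem_openSegment (key b hb hab.symm)⟩
  · have ha : a ∈ M.CE e := by simp [h]
    exact ⟨a, ha, hab, by rw [h, Finset.pair_comm], key a ha hab,
      exists_sub_eq_neg_smul_of_mem_openSegment (key a ha hab)⟩

/-- The other dual center of an inner edge lies opposite the given one, as seen from the crossing
point. -/
lemma exists_opposite_y {e : Fin ne} {ν : Fin nv} (hν : ν ∈ M.VE e) (h2 : (M.VE e).card ≠ 1) :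
    ∃ μ ∈ M.VE e, μ ≠ ν ∧ M.VE e = {ν, μ} ∧ M.cross e ∈ openSegment ℝ (M.y ν) (M.y μ) ∧
      ∃ τ : ℝ, 0 < τ ∧ M.y μ - M.cross e = -(τ • (M.y ν - M.cross e)) := by
  obtain ⟨a, b, hab, h⟩ := Finset.card_eq_two.1 ((M.card_VE e).resolve_left h2)
  have key : ∀ μ ∈ M.VE e, μ ≠ ν → M.cross e ∈ openSegment ℝ (M.y ν) (M.y μ) :=
    fun μ hμ hne => M.cross_mem_primary e ν hν μ hμ hne.symm
  have hν' := hν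
  rw [h, Finset.mem_insert, Finset.mem_singleton] at hν'
  rcases hν' with rfl | rfl
  · have hb : b ∈ M.VE e := by simp [h]
    exact ⟨b, hb, hab.symm, h, key b hb hab.symm,
      exists_sub_eq_neg_smul_of_mem_openSegment (key b hb hab.symm)⟩
  · have ha : a ∈ M.VE e := by simp [h]
    exact ⟨a, ha, hab, by rw [h, Finset.pair_comm], key a ha hab,
      exists_sub_eq_neg_smul_of_mem_openSegment (key a ha hab)⟩

lemma eq_of_mem_VE_of_card_eq_one {e : Fin ne} (h1 : (M.VE e).card = 1) {ν μ : Fin nv}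
    (hν : ν ∈ M.VE e) (hμ : μ ∈ M.VE e) : μ = ν :=
  Finset.card_le_one.1 h1.le μ hμ ν hν

lemma x_mem_diamond {e : Fin ne} {i : Fin nc} (hi : i ∈ M.CE e) : M.x i ∈ M.diamond e :=
  subset_convexHull _ _ (Or.inl ⟨i, hi, rfl⟩)

lemma y_mem_diamond {e : Fin ne} {ν : Fin nv} (hν : ν ∈ M.VE e) : M.y ν ∈ M.diamond e :=
  subset_convexHull _ _ (Or.inr ⟨ν, hν, rfl⟩)

lemma convex_diamond (e : Fin ne) : Convex ℝ (M.diamond e) := convex_convexHull _ _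

lemma finite_vertices (e : Fin ne) : (M.x '' M.CE e ∪ M.y '' M.VE e).Finite :=
  ((Finset.finite_toSet _).image _).union ((Finset.finite_toSet _).image _)

lemma isClosed_diamond (e : Fin ne) : IsClosed (M.diamond e) :=
  (M.finite_vertices e).isClosed_convexHull ℝ

lemma dualEdge_subset_diamond (e : Fin ne) : M.dualEdge e ⊆ M.diamond e :=
  convexHull_mono Set.subset_union_left

lemma cross_mem_dualEdge (e : Fin ne) : M.cross e ∈ M.dualEdge e := by
  obtain ⟨i, hi⟩ := M.CE_nonempty e
  obtain ⟨j, hj, -, -, hc, -⟩ := M.exists_opposite_x hi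
  exact (convex_convexHull ℝ _).openSegment_subset (subset_convexHull _ (M.x '' M.CE e) ⟨i, hi, rfl⟩)
    (subset_convexHull _ (M.x '' M.CE e) ⟨j, hj, rfl⟩) hc

lemma cross_mem_diamond (e : Fin ne) : M.cross e ∈ M.diamond e :=
  M.dualEdge_subset_diamond e (M.cross_mem_dualEdge e)

lemma iUnion_diamond : ⋃ e, M.diamond e = closure Ω := M.cover

lemma diamond_subset (e : Fin ne) : M.diamond e ⊆ closure Ω := by
  rw [← M.iUnion_diamond]; exact Set.subset_iUnion _ e

lemma exists_mem_diamond {z : Plane} (hz : z ∈ closure Ω) : ∃ e, z ∈ M.diamond e := by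
  rw [← M.iUnion_diamond] at hz; exact Set.mem_iUnion.1 hz

lemma planeDet_cross_ne_zero {e : Fin ne} {i : Fin nc} (hi : i ∈ M.CE e) {ν : Fin nv}
    (hν : ν ∈ M.VE e) : planeDet (M.x i - M.cross e) (M.y ν - M.cross e) ≠ 0 :=
  planeDet_ne_zero_of_inner_eq_zero (sub_ne_zero.2 (M.x_ne_cross e i hi))
    (sub_ne_zero.2 (M.y_ne_cross e ν hν)) (M.orthogonal e i hi ν hν)

lemma triangle_subset_diamond {e : Fin ne} {i : Fin nc} (hi : i ∈ M.CE e) {ν : Fin nv}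
    (hν : ν ∈ M.VE e) : convexHull ℝ {M.cross e, M.x i, M.y ν} ⊆ M.diamond e := by
  refine convexHull_min ?_ (M.convex_diamond e)
  rintro p (rfl | rfl | rfl)
  exacts [M.cross_mem_diamond e, M.x_mem_diamond hi, M.y_mem_diamond hν]

lemma interior_diamond_nonempty (e : Fin ne) : (interior (M.diamond e)).Nonempty := by
  obtain ⟨i, hi⟩ := M.CE_nonempty e
  obtain ⟨ν, hν⟩ := M.VE_nonempty e
  exact (interior_triangle_nonempty (M.planeDet_cross_ne_zero hi hν)).mono
    (interior_mono (M.triangle_subset_diamond hi hν))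

lemma closure_interior_diamond (e : Fin ne) : closure (interior (M.diamond e)) = M.diamond e := by
  rw [(M.convex_diamond e).closure_interior_eq_closure_of_nonempty_interior
    (M.interior_diamond_nonempty e), (M.isClosed_diamond e).closure_eq]

/-- Two different diamonds are separated by a line. -/
lemma exists_separating {e e' : Fin ne} (h : e ≠ e') :
    ∃ (f : StrongDual ℝ Plane) (γ : ℝ), f ≠ 0 ∧ (∀ p ∈ M.diamond e, f p ≤ γ) ∧
      ∀ p ∈ M.diamond e', γ ≤ f p := by
  obtain ⟨f, γ, h1, h2⟩ := geometric_hahn_banach_open_open (M.convex_diamond e).interior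
    isOpen_interior (M.convex_diamond e').interior isOpen_interior (M.nonoverlapping e e' h)
  refine ⟨f, γ, ?_, ?_, ?_⟩
  · rintro rfl
    obtain ⟨p, hp⟩ := M.interior_diamond_nonempty e
    obtain ⟨q, hq⟩ := M.interior_diamond_nonempty e'
    exact lt_asymm (h1 p hp) (h2 q hq)
  · rw [← M.closure_interior_diamond e]
    exact fun p hp => closure_minimal (fun q hq => (h1 q hq).le)
      (isClosed_le f.continuous continuous_const) hp
  · rw [← M.closure_interior_diamond e']
    exact fun p hp => closure_minimal (fun q hq => (h2 q hq).le)
      (isClosed_le continuous_const f.continuous) hp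

/-- A point in the interior of a diamond lies in no other diamond. -/
lemma eq_of_mem_interior_diamond {e e' : Fin ne} {z : Plane} (hz : z ∈ interior (M.diamond e))
    (hz' : z ∈ M.diamond e') : e' = e := by
  by_contra h
  obtain ⟨f, γ, hf, h1, h2⟩ := M.exists_separating (Ne.symm h)
  exact hf (StrongDual.eq_zero_of_isMax_interior hz h1
    (le_antisymm (h1 z (interior_subset hz)) (h2 z hz')))

/-- A linear functional that is maximal on a diamond at the crossing point is constant on the
dual edge; this forces the dual edge to be a side of the diamond, which is then a boundary
triangle. -/
lemma card_VE_eq_one_of_isMax_cross {e : Fin ne} {f : StrongDual ℝ Plane} {γ : ℝ} (hf : f ≠ 0)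
    (hmax : ∀ p ∈ M.diamond e, f p ≤ γ) (hc : f (M.cross e) = γ) :
    (M.VE e).card = 1 ∧ ∀ ν ∈ M.VE e, f (M.y ν) < γ := by
  have hlt : ∀ ν ∈ M.VE e, f (M.y ν) < γ := by
    intro ν hν
    refine lt_of_le_of_ne (hmax _ (M.y_mem_diamond hν)) fun hy => hf ?_
    obtain ⟨i, hi⟩ := M.CE_nonempty e
    obtain ⟨j, hj, -, -, -, τ, hτ, hij⟩ := M.exists_opposite_x hi
    have h1 := hmax _ (M.x_mem_diamond hi)
    have h2 := hmax _ (M.x_mem_diamond hj)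
    have h3 := congrArg f hij
    simp only [map_sub, map_neg, map_smul, smul_eq_mul] at h3
    refine StrongDual.eq_zero_of_planeDet_ne_zero (M.planeDet_cross_ne_zero hi hν) ?_ ?_
    · rw [map_sub]; nlinarith
    · rw [map_sub, hy, hc, sub_self]
  refine ⟨?_, hlt⟩
  by_contra h2
  obtain ⟨ν, hν⟩ := M.VE_nonempty e
  obtain ⟨μ, hμ, -, -, -, τ, hτ, h⟩ := M.exists_opposite_y hν h2
  have h1 := hlt ν hν
  have h2 := hlt μ hμ
  have h3 := congrArg f h
  simp only [map_sub, map_neg, map_smul, smul_eq_mul] at h3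
  nlinarith

/-- A point of two diamonds that has a positive component towards the primary center `i` of one
of them lies in a common face with vertex `i`. -/
lemma mem_CE_of_inner_pos {e e' : Fin ne} {z : Plane} (hz : z ∈ M.diamond e)
    (hz' : z ∈ M.diamond e') {i : Fin nc} (hi : i ∈ M.CE e)
    (hpos : 0 < inner ℝ (z - M.cross e) (M.x i - M.cross e)) : i ∈ M.CE e' := by
  by_contra hni
  have hne : e ≠ e' := by rintro rfl; exact hni hi
  refine hpos.not_ge (inner_le_zero_of_mem_convexHull ?_ z (M.conforming e e' hne ⟨hz, hz'⟩))
  rintro p (⟨j, hj, rfl⟩ | ⟨ν, hν, rfl⟩)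
  · rw [Finset.mem_coe, Finset.mem_inter] at hj
    obtain ⟨k, hk, -, hCE, -, τ, hτ, h⟩ := M.exists_opposite_x hi
    have hjk : j = k := by
      have := hj.1
      rw [hCE, Finset.mem_insert, Finset.mem_singleton] at this
      exact this.resolve_left (by rintro rfl; exact hni hj.2)
    rw [hjk, h, inner_neg_left, real_inner_smul_left]
    have := real_inner_self_nonneg (x := M.x i - M.cross e)
    nlinarith
  · rw [Finset.mem_coe, Finset.mem_inter] at hν
    rw [real_inner_comm, M.orthogonal e i hi ν hν.1]

lemma mem_VE_of_inner_pos {e e' : Fin ne} {z : Plane} (hz : z ∈ M.diamond e)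
    (hz' : z ∈ M.diamond e') {ν : Fin nv} (hν : ν ∈ M.VE e)
    (hpos : 0 < inner ℝ (z - M.cross e) (M.y ν - M.cross e)) : ν ∈ M.VE e' := by
  by_contra hni
  have hne : e ≠ e' := by rintro rfl; exact hni hν
  refine hpos.not_ge (inner_le_zero_of_mem_convexHull ?_ z (M.conforming e e' hne ⟨hz, hz'⟩))
  rintro p (⟨j, hj, rfl⟩ | ⟨μ, hμ, rfl⟩)
  · rw [Finset.mem_coe, Finset.mem_inter] at hj
    rw [M.orthogonal e j hj.1 ν hν]
  · rw [Finset.mem_coe, Finset.mem_inter] at hμ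
    have hμν : μ ≠ ν := by rintro rfl; exact hni hμ.2
    have h2 : (M.VE e).card ≠ 1 := fun h1 => hμν (M.eq_of_mem_VE_of_card_eq_one h1 hν hμ.1)
    obtain ⟨k, hk, -, hVE, -, τ, hτ, h⟩ := M.exists_opposite_y hν h2
    have hμk : μ = k := by
      have := hμ.1
      rw [hVE, Finset.mem_insert, Finset.mem_singleton] at this
      exact this.resolve_left hμν
    rw [hμk, h, inner_neg_left, real_inner_smul_left]
    have := real_inner_self_nonneg (x := M.y ν - M.cross e)
    nlinarith

/-- A diamond that contains the dual center `ν` has it as a vertex, if `ν` is a vertex at all. -/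
lemma mem_VE_of_y_mem {e e' : Fin ne} {ν : Fin nv} (hν : ν ∈ M.VE e)
    (h : M.y ν ∈ M.diamond e') : ν ∈ M.VE e' :=
  M.mem_VE_of_inner_pos (M.y_mem_diamond hν) h hν
    (real_inner_self_pos.2 (sub_ne_zero.2 (M.y_ne_cross e ν hν)))

/-- The points of a boundary triangle that have no component towards its dual center lie on the
boundary edge. -/
lemma notMem_of_boundary (hΩ : IsOpen Ω) {e : Fin ne} (h1 : (M.VE e).card = 1) {z : Plane}
    (hz : z ∈ M.diamond e) {ν : Fin nv} (hν : ν ∈ M.VE e)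
    (hle : inner ℝ (z - M.cross e) (M.y ν - M.cross e) ≤ 0) : z ∉ Ω := by
  have hVE : M.VE e = {ν} := by
    obtain ⟨μ, hμ⟩ := Finset.card_eq_one.1 h1
    rw [hμ, Finset.mem_singleton] at hν
    rw [hμ, hν]
  have hne : (M.x '' M.CE e).Nonempty := (M.CE_nonempty e).to_set.image _
  have hz' := hz
  rw [diamond, hVE, Finset.coe_singleton, Set.image_singleton, Set.union_singleton,
    convexHull_insert hne, mem_convexJoin] at hz'
  obtain ⟨_, rfl, q, hq, s, t, hs, ht, hst, rfl⟩ := hz'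
  have hq0 : inner ℝ (q - M.cross e) (M.y ν - M.cross e) = 0 := by
    refine le_antisymm (inner_le_zero_of_mem_convexHull ?_ q hq) ?_
    · rintro _ ⟨i, hi, rfl⟩
      rw [M.orthogonal e i hi ν hν]
    · have := inner_le_zero_of_mem_convexHull (s := M.x '' M.CE e) (c := M.cross e)
        (a := -(M.y ν - M.cross e)) ?_ q hq
      · rw [inner_neg_right] at this; linarith
      · rintro _ ⟨i, hi, rfl⟩
        rw [inner_neg_right, M.orthogonal e i hi ν hν, neg_zero]
  have hdec : s • M.y ν + t • q - M.cross e
      = s • (M.y ν - M.cross e) + t • (q - M.cross e) := by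
    have : t = 1 - s := by linarith
    subst this
    module
  rw [hdec, inner_add_left, real_inner_smul_left, real_inner_smul_left, hq0, mul_zero,
    add_zero] at hle
  have hpos : 0 < inner ℝ (M.y ν - M.cross e) (M.y ν - M.cross e) :=
    real_inner_self_pos.2 (sub_ne_zero.2 (M.y_ne_cross e ν hν))
  have hs0 : s = 0 := le_antisymm (by by_contra hcon; push Not at hcon; nlinarith) hs
  have ht1 : t = 1 := by linarith
  rw [hs0, ht1, zero_smul, one_smul, zero_add]
  have := M.boundary e h1 hq
  rw [hΩ.frontier_eq] at this
  exact this.2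

lemma eq_smul_of_inner_eq_zero {a b v : Plane} (ha : a ≠ 0) (hb : b ≠ 0) (hab : inner ℝ a b = 0)
    (hv : inner ℝ v a = 0) : ∃ τ : ℝ, v = τ • b := by
  have hD := planeDet_ne_zero_of_inner_eq_zero ha hb hab
  have hvb := planeDet_smul a b v
  have h0 : planeDet v b = 0 := by
    have h1 : planeDet v b * inner ℝ a a = 0 := by
      have := congrArg (inner ℝ · a) hvb
      simp only [inner_add_left, real_inner_smul_left, hv, mul_zero] at this
      rw [real_inner_comm a b, hab] at this
      linarith
    exact (mul_eq_zero.1 h1).resolve_right (real_inner_self_pos.2 ha).ne'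
  refine ⟨(planeDet a b)⁻¹ * planeDet a v, ?_⟩
  rw [h0, zero_smul, zero_add] at hvb
  rw [mul_smul, ← hvb, smul_smul, inv_mul_cancel₀ hD, one_smul]

/-- A point without positive components towards the primary centers lies on the line of the primary
edge, as these centers lie in opposite directions. -/
lemma inner_x_eq_zero {e : Fin ne} {z : Plane}
    (h : ∀ i ∈ M.CE e, inner ℝ (z - M.cross e) (M.x i - M.cross e) ≤ 0) :
    ∀ i ∈ M.CE e, inner ℝ (z - M.cross e) (M.x i - M.cross e) = 0 := by
  intro i hi
  obtain ⟨j, hj, -, -, -, τ, hτ, hij⟩ := M.exists_opposite_x hi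
  have h1 := h i hi
  have h2 := h j hj
  rw [hij, inner_neg_right, real_inner_smul_right] at h2
  nlinarith

lemma inner_y_eq_zero {e : Fin ne} {z : Plane} (hcard : (M.VE e).card ≠ 1)
    (h : ∀ ν ∈ M.VE e, inner ℝ (z - M.cross e) (M.y ν - M.cross e) ≤ 0) :
    ∀ ν ∈ M.VE e, inner ℝ (z - M.cross e) (M.y ν - M.cross e) = 0 := by
  intro ν hν
  obtain ⟨μ, hμ, -, -, -, τ, hτ, hij⟩ := M.exists_opposite_y hν hcard
  have h1 := h ν hν
  have h2 := h μ hμ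
  rw [hij, inner_neg_right, real_inner_smul_right] at h2
  nlinarith

lemma eq_cross_of_inner_eq_zero {e : Fin ne} {z : Plane} {i : Fin nc} (hi : i ∈ M.CE e)
    {ν : Fin nv} (hν : ν ∈ M.VE e) (hx : inner ℝ (z - M.cross e) (M.x i - M.cross e) = 0)
    (hy : inner ℝ (z - M.cross e) (M.y ν - M.cross e) = 0) : z = M.cross e := by
  obtain ⟨τ, hτ⟩ := eq_smul_of_inner_eq_zero (sub_ne_zero.2 (M.x_ne_cross e i hi))
    (sub_ne_zero.2 (M.y_ne_cross e ν hν)) (M.orthogonal e i hi ν hν) hx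
  rw [hτ, real_inner_smul_left] at hy
  have h0 := (mul_eq_zero.1 hy).resolve_right
    (real_inner_self_pos.2 (sub_ne_zero.2 (M.y_ne_cross e ν hν))).ne'
  rw [h0, zero_smul] at hτ
  exact sub_eq_zero.1 hτ

/-- Two diamonds that meet at a point of `Ω` other than a dual center share a primary center. -/
lemma exists_common_x (hΩ : IsOpen Ω) {e e' : Fin ne} {z : Plane} (hzΩ : z ∈ Ω)
    (hz : z ∈ M.diamond e) (hz' : z ∈ M.diamond e') (hzy : ∀ ν, z ≠ M.y ν) :
    ∃ i, i ∈ M.CE e ∧ i ∈ M.CE e' := by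
  by_contra hcon
  push Not at hcon
  have hne : e ≠ e' := by
    rintro rfl; obtain ⟨i, hi⟩ := M.CE_nonempty e; exact hcon i hi hi
  have hx0 := M.inner_x_eq_zero (e := e) (z := z) fun i hi => by
    by_contra h; push Not at h; exact hcon i hi (M.mem_CE_of_inner_pos hz hz' hi h)
  obtain ⟨i, hi⟩ := M.CE_nonempty e
  obtain ⟨f, γ, hf, h1, h2⟩ := M.exists_separating hne
  have hfz : f z = γ := le_antisymm (h1 z hz) (h2 z hz')
  by_cases hy : ∃ ν ∈ M.VE e, 0 < inner ℝ (z - M.cross e) (M.y ν - M.cross e)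
  · -- the separating line contains `z` and `y ν`, hence the crossing point on their line
    obtain ⟨ν, hν, hpos⟩ := hy
    have hfy : f (M.y ν) = γ := le_antisymm (h1 _ (M.y_mem_diamond hν))
      (h2 _ (M.y_mem_diamond (M.mem_VE_of_inner_pos hz hz' hν hpos)))
    obtain ⟨τ, hτ⟩ := eq_smul_of_inner_eq_zero (sub_ne_zero.2 (M.x_ne_cross e i hi))
      (sub_ne_zero.2 (M.y_ne_cross e ν hν)) (M.orthogonal e i hi ν hν) (hx0 i hi)
    have hτ1 : τ ≠ 1 := by
      rintro rfl
      rw [one_smul] at hτ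
      exact hzy ν (sub_left_injective hτ)
    have h3 := congrArg f hτ
    simp only [map_sub, map_smul, smul_eq_mul, hfz, hfy] at h3
    have hfc : f (M.cross e) = γ := by
      have : (1 - τ) * (γ - f (M.cross e)) = 0 := by linarith
      have := (mul_eq_zero.1 this).resolve_left (sub_ne_zero.2 hτ1.symm)
      linarith
    exact ((M.card_VE_eq_one_of_isMax_cross hf h1 hfc).2 ν hν).ne hfy
  · push Not at hy
    obtain ⟨ν, hν⟩ := M.VE_nonempty e
    by_cases hcard : (M.VE e).card = 1
    · exact M.notMem_of_boundary hΩ hcard hz hν (hy ν hν) hzΩ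
    · rw [M.eq_cross_of_inner_eq_zero hi hν (hx0 i hi) (M.inner_y_eq_zero hcard hy ν hν)] at hfz
      exact hcard (M.card_VE_eq_one_of_isMax_cross hf h1 hfz).1

/-- Two diamonds that meet at a point of `Ω` other than a primary center share a dual center. -/
lemma exists_common_y (hΩ : IsOpen Ω) {e e' : Fin ne} {z : Plane} (hzΩ : z ∈ Ω)
    (hz : z ∈ M.diamond e) (hz' : z ∈ M.diamond e') (hzx : ∀ i, z ≠ M.x i) :
    ∃ ν, ν ∈ M.VE e ∧ ν ∈ M.VE e' := by
  by_contra hcon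
  push Not at hcon
  have hne : e ≠ e' := by
    rintro rfl; obtain ⟨i, hi⟩ := M.VE_nonempty e; exact hcon i hi hi
  have hyle : ∀ ν ∈ M.VE e, inner ℝ (z - M.cross e) (M.y ν - M.cross e) ≤ 0 := fun ν hν => by
    by_contra h; push Not at h; exact hcon ν hν (M.mem_VE_of_inner_pos hz hz' hν h)
  obtain ⟨ν, hν⟩ := M.VE_nonempty e
  have hcard : (M.VE e).card ≠ 1 := fun h =>
    M.notMem_of_boundary hΩ h hz hν (hyle ν hν) hzΩ
  have hy0 := M.inner_y_eq_zero hcard hyle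
  obtain ⟨f, γ, hf, h1, h2⟩ := M.exists_separating hne
  have hfz : f z = γ := le_antisymm (h1 z hz) (h2 z hz')
  by_cases hx : ∃ i ∈ M.CE e, 0 < inner ℝ (z - M.cross e) (M.x i - M.cross e)
  · obtain ⟨i, hi, hpos⟩ := hx
    have hfx : f (M.x i) = γ := le_antisymm (h1 _ (M.x_mem_diamond hi))
      (h2 _ (M.x_mem_diamond (M.mem_CE_of_inner_pos hz hz' hi hpos)))
    obtain ⟨τ, hτ⟩ := eq_smul_of_inner_eq_zero (sub_ne_zero.2 (M.y_ne_cross e ν hν))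
      (sub_ne_zero.2 (M.x_ne_cross e i hi))
      (by rw [real_inner_comm]; exact M.orthogonal e i hi ν hν) (hy0 ν hν)
    have hτ1 : τ ≠ 1 := by
      rintro rfl
      rw [one_smul] at hτ
      exact hzx i (sub_left_injective hτ)
    have h3 := congrArg f hτ
    simp only [map_sub, map_smul, smul_eq_mul, hfz, hfx] at h3
    have hfc : f (M.cross e) = γ := by
      have : (1 - τ) * (γ - f (M.cross e)) = 0 := by linarith
      have := (mul_eq_zero.1 this).resolve_left (sub_ne_zero.2 hτ1.symm)
      linarith
    exact hcard (M.card_VE_eq_one_of_isMax_cross hf h1 hfc).1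
  · push Not at hx
    obtain ⟨i, hi⟩ := M.CE_nonempty e
    rw [M.eq_cross_of_inner_eq_zero hi hν (M.inner_x_eq_zero hx i hi) (hy0 ν hν)] at hfz
    exact hcard (M.card_VE_eq_one_of_isMax_cross hf h1 hfz).1

/-- Diamonds that meet in `Ω` do not have two primary centers in common. -/
lemma eq_of_common_x (hΩ : IsOpen Ω) {e e' : Fin ne} {z : Plane} (hzΩ : z ∈ Ω)
    (hz : z ∈ M.diamond e) (hz' : z ∈ M.diamond e') {i j : Fin nc} (hij : i ≠ j)
    (hi : i ∈ M.CE e) (hi' : i ∈ M.CE e') (hj : j ∈ M.CE e) (hj' : j ∈ M.CE e') : e = e' := by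
  by_contra hne
  obtain ⟨f, γ, hf, h1, h2⟩ := M.exists_separating hne
  have hc' : M.cross e ∈ M.diamond e' := (M.convex_diamond e').openSegment_subset
    (M.x_mem_diamond hi') (M.x_mem_diamond hj') (M.cross_mem_dual e i hi j hj hij)
  obtain ⟨hcard, hlt⟩ := M.card_VE_eq_one_of_isMax_cross hf h1
    (le_antisymm (h1 _ (M.cross_mem_diamond e)) (h2 _ hc'))
  obtain ⟨ν, hν⟩ := M.VE_nonempty e
  refine M.notMem_of_boundary hΩ hcard hz hν ?_ hzΩ
  by_contra hpos
  push Not at hpos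
  exact (hlt ν hν).not_ge (h2 _ (M.y_mem_diamond (M.mem_VE_of_inner_pos hz hz' hν hpos)))

/-- Different diamonds do not have two dual centers in common. -/
lemma eq_of_common_y {e e' : Fin ne} {ν μ : Fin nv} (hνμ : ν ≠ μ)
    (hν : ν ∈ M.VE e) (hν' : ν ∈ M.VE e') (hμ : μ ∈ M.VE e) (hμ' : μ ∈ M.VE e') : e = e' := by
  by_contra hne
  obtain ⟨f, γ, hf, h1, h2⟩ := M.exists_separating hne
  have hc' : M.cross e ∈ M.diamond e' := (M.convex_diamond e').openSegment_subset
    (M.y_mem_diamond hν') (M.y_mem_diamond hμ') (M.cross_mem_primary e ν hν μ hμ hνμ)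
  obtain ⟨hcard, -⟩ := M.card_VE_eq_one_of_isMax_cross hf h1
    (le_antisymm (h1 _ (M.cross_mem_diamond e)) (h2 _ hc'))
  exact hνμ (M.eq_of_mem_VE_of_card_eq_one hcard hμ hν)

/-- All the diamonds that contain a given point of `Ω` have a center in common. -/
lemma exists_common_center (hΩ : IsOpen Ω) {z : Plane} (hzΩ : z ∈ Ω) :
    (∃ i, ∀ e, z ∈ M.diamond e → i ∈ M.CE e) ∨ ∃ ν, ∀ e, z ∈ M.diamond e → ν ∈ M.VE e := by
  obtain ⟨e, hz⟩ := M.exists_mem_diamond (subset_closure hzΩ)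
  obtain ⟨i, hi⟩ := M.CE_nonempty e
  obtain ⟨ν, hν⟩ := M.VE_nonempty e
  by_cases hx : ∀ i ∈ M.CE e, inner ℝ (z - M.cross e) (M.x i - M.cross e) ≤ 0
  swap
  · push Not at hx
    obtain ⟨i, hi, h⟩ := hx
    exact Or.inl ⟨i, fun e' hz' => M.mem_CE_of_inner_pos hz hz' hi h⟩
  by_cases hy : ∀ ν ∈ M.VE e, inner ℝ (z - M.cross e) (M.y ν - M.cross e) ≤ 0
  swap
  · push Not at hy
    obtain ⟨ν, hν, h⟩ := hy
    exact Or.inr ⟨ν, fun e' hz' => M.mem_VE_of_inner_pos hz hz' hν h⟩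
  have hcard : (M.VE e).card ≠ 1 := fun h =>
    M.notMem_of_boundary hΩ h hz hν (hy ν hν) hzΩ
  -- the remaining point is the crossing point of an inner diamond, which lies in its interior
  have hzc := M.eq_cross_of_inner_eq_zero hi hν (M.inner_x_eq_zero hx i hi)
    (M.inner_y_eq_zero hcard hy ν hν)
  refine Or.inl ⟨i, fun e' hz' => ?_⟩
  by_cases hne : e = e'
  · exact hne ▸ hi
  · obtain ⟨f, γ, hf, h1, h2⟩ := M.exists_separating hne
    rw [hzc] at hz hz'
    exact absurd (M.card_VE_eq_one_of_isMax_cross hf h1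
      (le_antisymm (h1 _ hz) (h2 _ hz'))).1 hcard

/-! ### Edge lengths and areas -/

lemma d_eq {e : Fin ne} {i j : Fin nc} (hCE : M.CE e = {i, j})
    (hc : M.cross e ∈ openSegment ℝ (M.x i) (M.x j)) :
    M.d e = ‖M.x i - M.cross e‖ + ‖M.x j - M.cross e‖ := by
  rw [d, dualEdge, convexHull_diam, hCE, Finset.coe_pair, Set.image_pair, Metric.diam_pair,
    ← dist_add_dist_of_mem_segment (openSegment_subset_segment ℝ _ _ hc), dist_eq_norm,
    dist_eq_norm, norm_sub_rev (M.cross e)]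

lemma d_pos (e : Fin ne) : 0 < M.d e := by
  obtain ⟨i, hi⟩ := M.CE_nonempty e
  obtain ⟨j, hj, -, hCE, hc, -⟩ := M.exists_opposite_x hi
  rw [M.d_eq hCE hc]
  have := norm_pos_iff.2 (sub_ne_zero.2 (M.x_ne_cross e i hi))
  positivity

lemma l_eq_of_boundary {e : Fin ne} {ν : Fin nv} (hVE : M.VE e = {ν}) :
    M.l e = ‖M.y ν - M.cross e‖ := by
  rw [l, primaryEdge, convexHull_diam, hVE, Finset.coe_singleton, Set.image_singleton,
    Metric.diam_pair, dist_comm, dist_eq_norm]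

lemma l_eq {e : Fin ne} {ν μ : Fin nv} (hVE : M.VE e = {ν, μ})
    (hc : M.cross e ∈ openSegment ℝ (M.y ν) (M.y μ)) :
    M.l e = ‖M.y ν - M.cross e‖ + ‖M.y μ - M.cross e‖ := by
  have hd := dist_add_dist_of_mem_segment (openSegment_subset_segment ℝ _ _ hc)
  rw [l, primaryEdge, convexHull_diam, hVE, Finset.coe_pair, Set.image_pair, Metric.diam_triple,
    ← dist_eq_norm, ← dist_eq_norm, dist_comm (M.y μ), hd, max_eq_right]
  rw [max_le_iff, ← hd, dist_comm (M.y ν)]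
  constructor <;> linarith [dist_nonneg (x := M.cross e) (y := M.y ν),
    dist_nonneg (x := M.cross e) (y := M.y μ)]

lemma l_pos (e : Fin ne) : 0 < M.l e := by
  obtain ⟨ν, hν⟩ := M.VE_nonempty e
  have := norm_pos_iff.2 (sub_ne_zero.2 (M.y_ne_cross e ν hν))
  by_cases h1 : (M.VE e).card = 1
  · obtain ⟨μ, hμ⟩ := Finset.card_eq_one.1 h1
    rw [hμ, Finset.mem_singleton] at hν
    rwa [M.l_eq_of_boundary hμ, ← hν]
  · obtain ⟨μ, hμ, -, hVE, hc, -⟩ := M.exists_opposite_y hν h1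
    rw [M.l_eq hVE hc]
    positivity

/-- The area of the half of a diamond on one side of the dual edge. -/
lemma volume_halfDiamond {e : Fin ne} {i j : Fin nc} (hi : i ∈ M.CE e) (hCE : M.CE e = {i, j})
    (hc : M.cross e ∈ openSegment ℝ (M.x i) (M.x j)) {ν : Fin nv} (hν : ν ∈ M.VE e) {τ : ℝ}
    (hτ : 0 < τ) (hij : M.x j - M.cross e = -(τ • (M.x i - M.cross e))) :
    MeasureTheory.volume.real (convexHull ℝ {M.x i, M.x j, M.y ν})
      = stdArea * ‖M.y ν - M.cross e‖ * M.d e := by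
  rw [volume_triangle, M.d_eq hCE hc]
  have hdet : planeDet (M.x j - M.x i) (M.y ν - M.x i)
      = -(1 + τ) * planeDet (M.x i - M.cross e) (M.y ν - M.cross e) := by
    have h1 : M.x j - M.x i = -((1 + τ) • (M.x i - M.cross e)) := by
      rw [← sub_sub_sub_cancel_right (M.x j) (M.x i) (M.cross e), hij]; module
    have h2 : M.y ν - M.x i = (M.y ν - M.cross e) - (M.x i - M.cross e) := by abel
    rw [h1, h2]
    generalize M.x i - M.cross e = a
    generalize M.y ν - M.cross e = b
    simp [planeDet]; ring
  rw [hdet, abs_mul, abs_planeDet_of_inner_eq_zero (M.orthogonal e i hi ν hν), hij, norm_neg,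
    norm_smul, Real.norm_of_nonneg hτ.le, abs_neg, abs_of_pos (by positivity : 0 < 1 + τ)]
  ring

/-- The two halves of an inner diamond cover it. -/
lemma diamond_eq_union {e : Fin ne} {i j : Fin nc} (hCE : M.CE e = {i, j}) {ν μ : Fin nv}
    (hVE : M.VE e = {ν, μ}) (hc : M.cross e ∈ openSegment ℝ (M.x i) (M.x j)) {τ : ℝ} (hτ : 0 < τ)
    (hνμ : M.y μ - M.cross e = -(τ • (M.y ν - M.cross e))) :
    M.diamond e = convexHull ℝ {M.x i, M.x j, M.y ν} ∪ convexHull ℝ {M.x i, M.x j, M.y μ} := by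
  have hi : M.x i ∈ M.diamond e := M.x_mem_diamond (by simp [hCE])
  have hj : M.x j ∈ M.diamond e := M.x_mem_diamond (by simp [hCE])
  have hν : M.y ν ∈ M.diamond e := M.y_mem_diamond (by simp [hVE])
  have hμ : M.y μ ∈ M.diamond e := M.y_mem_diamond (by simp [hVE])
  apply Set.Subset.antisymm
  swap
  · apply Set.union_subset <;> refine convexHull_min ?_ (M.convex_diamond e) <;>
      rintro p (rfl | rfl | rfl) <;> assumption
  intro z hz
  have hset : M.x '' M.CE e ∪ M.y '' M.VE e = {M.y μ, M.y ν, M.x i, M.x j} := by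
    rw [hCE, hVE, Finset.coe_pair, Finset.coe_pair, Set.image_pair, Set.image_pair]
    ext p; simp only [Set.mem_union, Set.mem_insert_iff, Set.mem_singleton_iff]; tauto
  rw [diamond, hset, convexHull_insert (by simp), mem_convexJoin] at hz
  obtain ⟨_, rfl, q, hq, s, t, hs, ht, hst, rfl⟩ := hz
  rw [convexHull_insert (by simp), mem_convexJoin, convexHull_pair] at hq
  obtain ⟨_, rfl, r, hr, u, v, hu, hv, huv, rfl⟩ := hq
  have hseg (ρ : Fin nv) : segment ℝ (M.x i) (M.x j) ⊆ convexHull ℝ {M.x i, M.x j, M.y ρ} := by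
    rw [← convexHull_pair]
    exact convexHull_mono (by intro p; simp only [Set.mem_insert_iff, Set.mem_singleton_iff]; tauto)
  have hcomb (ρ : Fin nv) (a b c : ℝ) (ha : 0 ≤ a) (hb : 0 ≤ b) (hc' : 0 ≤ c)
      (habc : a + b + c = 1) :
      a • M.y ρ + b • M.cross e + c • r ∈ convexHull ℝ {M.x i, M.x j, M.y ρ} := by
    have := (convex_convexHull ℝ {M.x i, M.x j, M.y ρ}).sum_mem (t := Finset.univ)
      (w := ![a, b, c]) (z := ![M.y ρ, M.cross e, r])
      (by intro k _; fin_cases k <;> simpa)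
      (by simpa [Fin.sum_univ_three] using habc)
      (by
        intro k _
        fin_cases k
        · exact subset_convexHull _ _ (by simp)
        · exact hseg ρ (openSegment_subset_segment ℝ _ _ hc)
        · exact hseg ρ hr)
    simpa [Fin.sum_univ_three] using this
  have hμ' : M.y μ = (1 + τ) • M.cross e - τ • M.y ν := by
    have : M.y μ = M.cross e + -(τ • (M.y ν - M.cross e)) := by rw [← hνμ]; abel
    rw [this]; module
  have ht' : t = 1 - s := by linarith
  have hv' : v = 1 - u := by linarith
  -- eliminate the dual center with the smaller relative weight by means of the crossing point
  rcases le_total (τ * s) (t * u) with h | h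
  · left
    have := hcomb ν (t * u - τ * s) (s * (1 + τ)) (t * v) (by linarith) (by positivity)
      (by positivity) (by subst ht' hv'; ring)
    convert this using 1
    rw [hμ']; module
  · right
    have hν' : M.y ν = (1 + τ⁻¹) • M.cross e - τ⁻¹ • M.y μ := by
      have h1 : (1 + τ⁻¹) = τ⁻¹ * (1 + τ) := by field_simp; ring
      rw [hμ', h1, smul_sub, smul_smul, smul_smul, inv_mul_cancel₀ hτ.ne', one_smul]; abel
    have h' : t * u * τ⁻¹ ≤ s := by
      rw [mul_inv_le_iff₀ hτ]; linarith
    have := hcomb μ (s - t * u * τ⁻¹) (t * u * (1 + τ⁻¹)) (t * v) (by linarith) (by positivity)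
      (by positivity) (by subst ht' hv'; ring)
    convert this using 1
    rw [hν']; module

/-- The area of a diamond is proportional to the product of the lengths of its diagonals. -/
lemma diamondArea_eq (e : Fin ne) : M.diamondArea e = stdArea * M.l e * M.d e := by
  obtain ⟨i, hi⟩ := M.CE_nonempty e
  obtain ⟨ν, hν⟩ := M.VE_nonempty e
  obtain ⟨j, hj, -, hCE, hc, τ, hτ, hij⟩ := M.exists_opposite_x hi
  by_cases h1 : (M.VE e).card = 1
  · have hVE : M.VE e = {ν} := by
      obtain ⟨μ, hμ⟩ := Finset.card_eq_one.1 h1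
      rw [hμ, Finset.mem_singleton] at hν
      rw [hμ, hν]
    rw [M.l_eq_of_boundary hVE, ← M.volume_halfDiamond hi hCE hc hν hτ hij, diamondArea, diamond,
      hCE, hVE, Finset.coe_pair, Finset.coe_singleton, Set.image_pair, Set.image_singleton,
      Set.insert_union, Set.singleton_union]
  · obtain ⟨μ, hμ, -, hVE, hc', σ, hσ, hνμ⟩ := M.exists_opposite_y hν h1
    have hU := M.diamond_eq_union hCE hVE hc hσ hνμ
    have hTν := M.volume_halfDiamond hi hCE hc hν hτ hij
    have hTμ := M.volume_halfDiamond hi hCE hc hμ hτ hij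
    have hfin (ρ : Fin nv) :
        MeasureTheory.volume (convexHull ℝ {M.x i, M.x j, M.y ρ}) ≠ ⊤ :=
      volume_convexHull_ne_top (by simp)
    have hmeas : MeasurableSet (convexHull ℝ {M.x i, M.x j, M.y μ}) :=
      (Set.Finite.isClosed_convexHull ℝ (by simp)).measurableSet
    have hsum := MeasureTheory.measureReal_union_add_inter (μ := MeasureTheory.volume)
      (s := convexHull ℝ {M.x i, M.x j, M.y ν}) hmeas (hfin ν) (hfin μ)
    -- the halves lie on different sides of the dual edge, so their intersection is null
    have hnull : MeasureTheory.volume.real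
        (convexHull ℝ {M.x i, M.x j, M.y ν} ∩ convexHull ℝ {M.x i, M.x j, M.y μ}) = 0 := by
      by_contra hne
      obtain ⟨z, hz⟩ := ((convex_convexHull ℝ _).inter
        (convex_convexHull ℝ _)).interior_nonempty_of_volume_ne_zero hne
      set b := M.y ν - M.cross e with hb
      have hb0 : b ≠ 0 := sub_ne_zero.2 (M.y_ne_cross e ν hν)
      have hbb := real_inner_self_pos.2 hb0
      have hx (k : Fin nc) (hk : k ∈ M.CE e) : inner ℝ b (M.x k) = inner ℝ b (M.cross e) := by
        have := M.orthogonal e k hk ν hν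
        rw [real_inner_comm, inner_sub_right] at this
        exact sub_eq_zero.1 this
      have hyν : inner ℝ b (M.cross e) ≤ inner ℝ b (M.y ν) := by
        rw [← sub_nonneg, ← inner_sub_right]; exact hbb.le
      have hyμ : inner ℝ b (M.y μ) ≤ inner ℝ b (M.cross e) := by
        rw [← sub_nonpos, ← inner_sub_right, hνμ, inner_neg_right, real_inner_smul_right]
        nlinarith
      have hlow : ∀ p ∈ convexHull ℝ {M.x i, M.x j, M.y ν},
          inner ℝ b (M.cross e) ≤ inner ℝ b p := by
        intro p hp
        have := StrongDual.le_of_mem_convexHull (f := -innerSL ℝ b)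
          (γ := -inner ℝ b (M.cross e)) (s := {M.x i, M.x j, M.y ν}) (by
            rintro q (rfl | rfl | rfl) <;>
              simp [hx i hi, hx j hj, hyν]) p hp
        simpa using this
      have hupp : ∀ p ∈ convexHull ℝ {M.x i, M.x j, M.y μ},
          inner ℝ b p ≤ inner ℝ b (M.cross e) := by
        intro p hp
        have := StrongDual.le_of_mem_convexHull (f := innerSL ℝ b)
          (γ := inner ℝ b (M.cross e)) (s := {M.x i, M.x j, M.y μ}) (by
            rintro q (rfl | rfl | rfl) <;>
              simp [hx i hi, hx j hj, hyμ]) p hp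
        simpa using this
      have hzm := interior_subset hz
      have hf0 : innerSL ℝ b = 0 := StrongDual.eq_zero_of_isMax_interior hz
        (γ := inner ℝ b (M.cross e)) (fun p hp => by simpa using hupp p hp.2)
        (by simpa using le_antisymm (hupp z hzm.2) (hlow z hzm.1))
      have : innerSL ℝ b b = 0 := by rw [hf0]; rfl
      rw [innerSL_apply_apply] at this
      exact hbb.ne' this
    rw [diamondArea, hU, M.l_eq hVE hc']
    linarith

lemma diamondArea_pos (e : Fin ne) : 0 < M.diamondArea e := by
  rw [M.diamondArea_eq]
  exact mul_pos (mul_pos stdArea_pos (M.l_pos e)) (M.d_pos e)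

lemma volume_real_pos_of_interior {s : Set Plane} (h : (interior s).Nonempty)
    (hs : Bornology.IsBounded s) : 0 < MeasureTheory.volume.real s :=
  ENNReal.toReal_pos (MeasureTheory.Measure.measure_pos_of_nonempty_interior _ h).ne'
    hs.measure_lt_top.ne

lemma cellArea_pos (hbdd : Bornology.IsBounded Ω) (i : Fin nc) : 0 < M.cellArea i := by
  refine volume_real_pos_of_interior ((M.cell_connected i).nonempty.mono (interior_mono ?_))
    (hbdd.closure.subset ?_)
  · refine Set.iUnion_subset fun e => Set.iUnion_subset fun hi => ?_
    refine Set.Subset.trans ?_ (Set.subset_biUnion_of_mem (u := fun e =>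
      convexHull ℝ (insert (M.x i) (M.primaryEdge e))) (M.mem_EC.2 hi))
    exact convexHull_mono (Set.insert_subset_insert (subset_convexHull _ _))
  · refine Set.iUnion₂_subset fun e he => Set.Subset.trans ?_ (M.diamond_subset e)
    refine convexHull_min (Set.insert_subset (M.x_mem_diamond (M.mem_EC.1 he))
      (convexHull_min (Set.insert_subset (M.cross_mem_diamond e) ?_) (M.convex_diamond e)))
      (M.convex_diamond e)
    rintro _ ⟨ν, hν, rfl⟩
    exact M.y_mem_diamond hν

lemma dualCellArea_pos (hbdd : Bornology.IsBounded Ω) (ν : Fin nv) : 0 < M.dualCellArea ν := by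
  refine volume_real_pos_of_interior ((M.dualCell_connected ν).nonempty.mono (interior_mono ?_))
    (hbdd.closure.subset ?_)
  · refine Set.iUnion_subset fun e => Set.iUnion_subset fun hν => ?_
    refine Set.Subset.trans ?_ (Set.subset_biUnion_of_mem (u := fun e =>
      convexHull ℝ (insert (M.y ν) (M.dualEdge e))) (M.mem_EV.2 hν))
    exact convexHull_mono (Set.insert_subset_insert (subset_convexHull _ _))
  · refine Set.iUnion₂_subset fun e he => Set.Subset.trans ?_ (M.diamond_subset e)
    exact convexHull_min (Set.insert_subset (M.y_mem_diamond (M.mem_EV.1 he))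
      (M.dualEdge_subset_diamond e)) (M.convex_diamond e)

lemma exists_mem_CE (i : Fin nc) : ∃ e, i ∈ M.CE e := by
  obtain ⟨z, hz⟩ := (M.cell_connected i).nonempty
  obtain ⟨e, hi, -⟩ := Set.mem_iUnion₂.1 (interior_subset hz)
  exact ⟨e, hi⟩

lemma exists_mem_VE (ν : Fin nv) : ∃ e, ν ∈ M.VE e := by
  obtain ⟨z, hz⟩ := (M.dualCell_connected ν).nonempty
  obtain ⟨e, hν, -⟩ := Set.mem_iUnion₂.1 (interior_subset hz)
  exact ⟨e, hν⟩

/-! ### Orientation signs -/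

lemma inner_normal_mul_inner_tangent {e : Fin ne} (i : Fin nc) {ν : Fin nv}
    (hν : ν ∈ M.VE e) :
    inner ℝ (M.normal e) (M.cross e - M.x i) * inner ℝ (M.tangent e) (M.cross e - M.y ν)
      = planeDet (M.x i - M.cross e) (M.y ν - M.cross e) := by
  have h1 := M.norm_normal e
  have h2 : inner ℝ (M.normal e) (M.normal e) = 1 := by
    rw [real_inner_self_eq_norm_sq, h1, one_pow]
  have h3 := M.normal_orthogonal e ν hν
  rw [← neg_sub (M.x i), ← neg_sub (M.y ν), inner_neg_right, inner_neg_right, neg_mul_neg, tangent]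
  revert h2 h3
  generalize M.x i - M.cross e = a
  generalize M.y ν - M.cross e = b
  generalize M.normal e = n
  intro h2 h3
  simp only [plane_inner_eq, planeDet, rotate90] at *
  simp
  linear_combination (n 0 * a 1 - n 1 * a 0) * h3 + (a 0 * b 1 - a 1 * b 0) * h2

lemma nSign_eq (e : Fin ne) (i : Fin nc) : M.nSign e i = 1 ∨ M.nSign e i = -1 := by
  unfold nSign; split_ifs <;> simp

lemma tSign_eq (e : Fin ne) (ν : Fin nv) : M.tSign e ν = 1 ∨ M.tSign e ν = -1 := by
  unfold tSign; split_ifs <;> simp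

lemma nSign_mul_self (e : Fin ne) (i : Fin nc) : M.nSign e i * M.nSign e i = 1 := by
  rcases M.nSign_eq e i with h | h <;> rw [h] <;> norm_num

lemma tSign_mul_self (e : Fin ne) (ν : Fin nv) : M.tSign e ν * M.tSign e ν = 1 := by
  rcases M.tSign_eq e ν with h | h <;> rw [h] <;> norm_num

/-- The product of the two indicators is the orientation of the triangle spanned by the crossing
point, the primary center and the dual center. -/
lemma nSign_mul_tSign {e : Fin ne} {i : Fin nc} (hi : i ∈ M.CE e) {ν : Fin nv}
    (hν : ν ∈ M.VE e) : M.nSign e i * M.tSign e ν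
      = if 0 < planeDet (M.x i - M.cross e) (M.y ν - M.cross e) then 1 else -1 := by
  have h := M.inner_normal_mul_inner_tangent i hν
  have h0 := M.planeDet_cross_ne_zero hi hν
  rw [← h] at h0 ⊢
  unfold nSign tSign
  have h1 := left_ne_zero_of_mul h0
  have h2 := right_ne_zero_of_mul h0
  rcases h1.lt_or_gt with h1 | h1 <;> rcases h2.lt_or_gt with h2 | h2
  · simp [h1.not_gt, h2.not_gt, mul_pos_of_neg_of_neg h1 h2]
  · simp [h1.not_gt, h2, (mul_neg_of_neg_of_pos h1 h2).not_gt]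
  · simp [h1, h2.not_gt, (mul_neg_of_pos_of_neg h1 h2).not_gt]
  · simp [h1, h2]

lemma nSign_opposite {e : Fin ne} {i j : Fin nc} (hi : i ∈ M.CE e) (hj : j ∈ M.CE e)
    (hij : j ≠ i) : M.nSign e j = -M.nSign e i := by
  obtain ⟨ν, hν⟩ := M.VE_nonempty e
  obtain ⟨k, hk, hki, hCE, -, τ, hτ, h⟩ := M.exists_opposite_x hi
  have hjk : j = k := by
    rw [hCE, Finset.mem_insert, Finset.mem_singleton] at hj
    exact hj.resolve_left hij
  have h0 := M.planeDet_cross_ne_zero hi hν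
  rw [← M.inner_normal_mul_inner_tangent i hν] at h0
  have h1 := left_ne_zero_of_mul h0
  have h2 : inner ℝ (M.normal e) (M.cross e - M.x j)
      = -(τ * inner ℝ (M.normal e) (M.cross e - M.x i)) := by
    rw [hjk, ← neg_sub, h, ← neg_sub (M.x i), neg_neg, real_inner_smul_right, inner_neg_right,
      mul_neg, neg_neg]
  unfold nSign
  rw [h2]
  rcases h1.lt_or_gt with h1 | h1
  · rw [if_neg h1.not_gt, if_pos (by nlinarith), neg_neg]
  · rw [if_pos h1, if_neg (by nlinarith)]

lemma tSign_opposite {e : Fin ne} {ν μ : Fin nv} (hν : ν ∈ M.VE e) (hμ : μ ∈ M.VE e)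
    (hνμ : μ ≠ ν) : M.tSign e μ = -M.tSign e ν := by
  obtain ⟨i, hi⟩ := M.CE_nonempty e
  have hcard : (M.VE e).card ≠ 1 := fun h => hνμ (M.eq_of_mem_VE_of_card_eq_one h hν hμ)
  obtain ⟨k, hk, hki, hVE, -, τ, hτ, h⟩ := M.exists_opposite_y hν hcard
  have hμk : μ = k := by
    rw [hVE, Finset.mem_insert, Finset.mem_singleton] at hμ
    exact hμ.resolve_left hνμ
  have h0 := M.planeDet_cross_ne_zero hi hν
  rw [← M.inner_normal_mul_inner_tangent i hν] at h0
  have h1 := right_ne_zero_of_mul h0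
  have h2 : inner ℝ (M.tangent e) (M.cross e - M.y μ)
      = -(τ * inner ℝ (M.tangent e) (M.cross e - M.y ν)) := by
    rw [hμk, ← neg_sub, h, ← neg_sub (M.y ν), neg_neg, real_inner_smul_right, inner_neg_right,
      mul_neg, neg_neg]
  unfold tSign
  rw [h2]
  rcases h1.lt_or_gt with h1 | h1
  · rw [if_neg h1.not_gt, if_pos (by nlinarith), neg_neg]
  · rw [if_pos h1, if_neg (by nlinarith)]

/-- Different diamonds with a common side lie on different sides of it. -/
lemma planeDet_mul_planeDet_neg {e e' : Fin ne} (hne : e ≠ e') {i : Fin nc} (hi : i ∈ M.CE e)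
    (hi' : i ∈ M.CE e') {ν : Fin nv} (hν : ν ∈ M.VE e) (hν' : ν ∈ M.VE e') :
    planeDet (M.x i - M.cross e) (M.y ν - M.cross e)
      * planeDet (M.x i - M.cross e') (M.y ν - M.cross e') < 0 := by
  obtain ⟨f, γ, hf, h1, h2⟩ := M.exists_separating hne
  have hx : f (M.x i) = γ := le_antisymm (h1 _ (M.x_mem_diamond hi)) (h2 _ (M.x_mem_diamond hi'))
  have hy : f (M.y ν) = γ := le_antisymm (h1 _ (M.y_mem_diamond hν)) (h2 _ (M.y_mem_diamond hν'))
  have hc : f (M.cross e) < γ := lt_of_le_of_ne (h1 _ (M.cross_mem_diamond e)) fun h =>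
    ((M.card_VE_eq_one_of_isMax_cross hf h1 h).2 ν hν).ne hy
  have hc' : γ < f (M.cross e') := lt_of_le_of_ne (h2 _ (M.cross_mem_diamond e')) fun h =>
    ((M.card_VE_eq_one_of_isMax_cross (e := e') (f := -f) (γ := -γ) (neg_ne_zero.2 hf)
      (fun p hp => neg_le_neg (h2 p hp)) (by rw [h]; rfl)).2 ν hν').ne (by rw [← hy]; rfl)
  have hid := congrArg f (planeDet_smul (M.x i - M.cross e) (M.y ν - M.cross e)
    (M.cross e' - M.x i))
  have hdet : planeDet (M.cross e' - M.x i) (M.y ν - M.cross e)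
      + planeDet (M.x i - M.cross e) (M.cross e' - M.x i)
      = -planeDet (M.x i - M.cross e') (M.y ν - M.cross e') := by
    simp [planeDet]; ring
  simp only [map_smul, map_add, map_sub, smul_eq_mul, hx, hy] at hid
  rw [← add_mul, hdet] at hid
  have h0 := M.planeDet_cross_ne_zero hi hν
  revert hid h0
  generalize planeDet (M.x i - M.cross e) (M.y ν - M.cross e) = D
  generalize planeDet (M.x i - M.cross e') (M.y ν - M.cross e') = D'
  intro hid h0
  have hD2 : 0 < D ^ 2 := by positivity
  have h3 : D ^ 2 * (f (M.cross e') - γ) = -(D * D') * (γ - f (M.cross e)) := by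
    linear_combination D * hid
  have h4 := mul_pos hD2 (sub_pos.2 hc')
  rw [h3] at h4
  linarith [(mul_pos_iff_of_pos_right (sub_pos.2 hc)).1 h4]

lemma sign_opposite {e e' : Fin ne} (hne : e ≠ e') {i : Fin nc} (hi : i ∈ M.CE e)
    (hi' : i ∈ M.CE e') {ν : Fin nv} (hν : ν ∈ M.VE e) (hν' : ν ∈ M.VE e') :
    M.nSign e' i * M.tSign e' ν = -(M.nSign e i * M.tSign e ν) := by
  rw [M.nSign_mul_tSign hi hν, M.nSign_mul_tSign hi' hν']
  rcases mul_neg_iff.1 (M.planeDet_mul_planeDet_neg hne hi hi' hν hν') with ⟨h1, h2⟩ | ⟨h1, h2⟩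
  · rw [if_pos h1, if_neg h2.not_gt]
  · rw [if_neg h1.not_gt, if_pos h2, neg_neg]

/-- Every side of a diamond belongs to a second diamond, since dual centers lie inside the
domain. -/
lemma exists_adjacent (hΩ : IsOpen Ω) {e : Fin ne} {i : Fin nc} (hi : i ∈ M.CE e) {ν : Fin nv}
    (hν : ν ∈ M.VE e) : ∃ e', e' ≠ e ∧ i ∈ M.CE e' ∧ ν ∈ M.VE e' := by
  -- a point `p` of the side in `Ω`
  obtain ⟨δ, hδ, hp⟩ : ∃ δ : ℝ, 0 < δ ∧ M.y ν + δ • (M.x i - M.y ν) ∈ Ω ∧ δ < 1 := by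
    have hcont : Continuous fun t : ℝ => M.y ν + t • (M.x i - M.y ν) := by fun_prop
    have hev : ∀ᶠ t in nhds (0 : ℝ), M.y ν + t • (M.x i - M.y ν) ∈ Ω ∧ t < 1 :=
      (hcont.continuousAt.eventually (hΩ.mem_nhds (by simpa using M.y_mem ν))).and
        (gt_mem_nhds one_pos)
    exact (((hev.filter_mono nhdsWithin_le_nhds).and self_mem_nhdsWithin).exists
      (f := nhdsWithin (0 : ℝ) (Set.Ioi 0))).imp fun t ht => ⟨ht.2, ht.1⟩
  obtain ⟨hpΩ, hδ1⟩ := hp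
  set p := M.y ν + δ • (M.x i - M.y ν) with hpdef
  have hpe : p ∈ M.diamond e := by
    have := (M.convex_diamond e) (M.y_mem_diamond hν) (M.x_mem_diamond hi)
      (sub_nonneg.2 hδ1.le) hδ.le (by ring)
    convert this using 1
    rw [hpdef]; module
  have hpc : p - M.cross e = (1 - δ) • (M.y ν - M.cross e) + δ • (M.x i - M.cross e) := by
    rw [hpdef]; module
  have hinx : 0 < inner ℝ (p - M.cross e) (M.x i - M.cross e) := by
    rw [hpc, inner_add_left, real_inner_smul_left, real_inner_smul_left, real_inner_comm,
      M.orthogonal e i hi ν hν]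
    have := real_inner_self_pos.2 (sub_ne_zero.2 (M.x_ne_cross e i hi))
    nlinarith
  have hiny : 0 < inner ℝ (p - M.cross e) (M.y ν - M.cross e) := by
    rw [hpc, inner_add_left, real_inner_smul_left, real_inner_smul_left,
      M.orthogonal e i hi ν hν]
    have := real_inner_self_pos.2 (sub_ne_zero.2 (M.y_ne_cross e ν hν))
    nlinarith
  suffices h : ∃ e', e' ≠ e ∧ p ∈ M.diamond e' by
    obtain ⟨e', hne, hpe'⟩ := h
    exact ⟨e', hne, M.mem_CE_of_inner_pos hpe hpe' hi hinx, M.mem_VE_of_inner_pos hpe hpe' hν hiny⟩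
  by_contra hcon
  push Not at hcon
  -- otherwise the points slightly beyond the side are covered by the diamond itself
  have hclosed : IsClosed (⋃ e' ∈ {e' | e' ≠ e}, M.diamond e') :=
    (Set.toFinite {e' | e' ≠ e}).isClosed_biUnion fun e' _ => M.isClosed_diamond e'
  have hpC : p ∈ Ω ∩ (⋃ e' ∈ {e' | e' ≠ e}, M.diamond e')ᶜ := by
    refine ⟨hpΩ, fun h => ?_⟩
    obtain ⟨e', hne, h⟩ := Set.mem_iUnion₂.1 h
    exact hcon e' hne h
  obtain ⟨ε, hε, hq⟩ : ∃ ε : ℝ, 0 < ε ∧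
      p + ε • (p - M.cross e) ∈ Ω ∩ (⋃ e' ∈ {e' | e' ≠ e}, M.diamond e')ᶜ := by
    have hcont : Continuous fun t : ℝ => p + t • (p - M.cross e) := by fun_prop
    have hev : ∀ᶠ t in nhds (0 : ℝ),
        p + t • (p - M.cross e) ∈ Ω ∩ (⋃ e' ∈ {e' | e' ≠ e}, M.diamond e')ᶜ :=
      hcont.continuousAt.eventually ((hΩ.inter hclosed.isOpen_compl).mem_nhds (by simpa using hpC))
    exact (((hev.filter_mono nhdsWithin_le_nhds).and self_mem_nhdsWithin).exists
      (f := nhdsWithin (0 : ℝ) (Set.Ioi 0))).imp fun t ht => ⟨ht.2, ht.1⟩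
  obtain ⟨e', he'⟩ := M.exists_mem_diamond (subset_closure hq.1)
  have hee : e' = e := by
    by_contra hne
    exact hq.2 (Set.mem_biUnion (x := e') hne he')
  rw [hee] at he'
  -- but the diamond lies on one side of the line through `x i` and `y ν`
  set D := planeDet (M.x i - M.cross e) (M.y ν - M.cross e) with hD
  have hD0 : D ≠ 0 := M.planeDet_cross_ne_zero hi hν
  have hD2 : 0 < D * D := mul_self_pos.2 hD0
  let f : StrongDual ℝ Plane := (-D) • innerSL ℝ (rotate90 (M.y ν - M.x i))
  have hf (v : Plane) : f v = -D * planeDet (M.y ν - M.x i) v := by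
    simp only [f, FunLike.coe_smul, Pi.smul_apply, innerSL_apply_apply, smul_eq_mul,
      plane_inner_eq, rotate90, planeDet]
    simp
    left; ring
  have hfx : f (M.x i - M.cross e) = D * D := by
    rw [hf, neg_mul, ← mul_neg]; congr 1; rw [hD]; simp [planeDet]; ring
  have hfy : f (M.y ν - M.cross e) = D * D := by
    rw [hf, neg_mul, ← mul_neg]; congr 1; rw [hD]; simp [planeDet]; ring
  have hmax : f (p + ε • (p - M.cross e)) ≤ f (M.cross e) + D * D := by
    refine StrongDual.le_of_mem_convexHull ?_ _ he'
    rintro _ (⟨j, hj, rfl⟩ | ⟨μ, hμ, rfl⟩)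
    · rw [← sub_le_iff_le_add', ← map_sub]
      by_cases hji : j = i
      · rw [hji, hfx]
      · obtain ⟨k, hk, -, hCE, -, τ, hτ, h⟩ := M.exists_opposite_x hi
        rw [hCE, Finset.coe_pair] at hj
        rw [hj.resolve_left hji, h, map_neg, map_smul, smul_eq_mul, hfx]
        nlinarith
    · rw [← sub_le_iff_le_add', ← map_sub]
      by_cases hji : μ = ν
      · rw [hji, hfy]
      · have hcard : (M.VE e).card ≠ 1 := fun h =>
          hji (M.eq_of_mem_VE_of_card_eq_one h hν hμ)
        obtain ⟨k, hk, -, hVE, -, τ, hτ, h⟩ := M.exists_opposite_y hν hcard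
        rw [hVE, Finset.coe_pair] at hμ
        rw [hμ.resolve_left hji, h, map_neg, map_smul, smul_eq_mul, hfy]
        nlinarith
  have hfp : f (p - M.cross e) = D * D := by
    rw [hpc, map_add, map_smul, map_smul, hfx, hfy, smul_eq_mul, smul_eq_mul]; ring
  rw [map_add, map_smul, hfp, smul_eq_mul] at hmax
  rw [map_sub] at hfp
  nlinarith

lemma EC_inter_EV_eq {e e' : Fin ne} (hne : e ≠ e') {i : Fin nc} (hi : i ∈ M.CE e)
    (hi' : i ∈ M.CE e') {ν : Fin nv} (hν : ν ∈ M.VE e) (hν' : ν ∈ M.VE e') :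
    M.EC i ∩ M.EV ν = {e, e'} := by
  ext e''
  rw [Finset.mem_insert, Finset.mem_singleton, Finset.mem_inter, mem_EC, mem_EV]
  constructor
  · rintro ⟨hi'', hν''⟩
    by_contra hcon
    push Not at hcon
    have h1 := M.sign_opposite hne hi hi' hν hν'
    have h2 := M.sign_opposite hcon.1.symm hi hi'' hν hν''
    have h3 := M.sign_opposite hcon.2.symm hi' hi'' hν' hν''
    have h4 := M.nSign_mul_tSign hi hν
    split_ifs at h4 <;> linarith
  · rintro (rfl | rfl)
    exacts [⟨hi, hν⟩, ⟨hi', hν'⟩]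

/-- Around the side from a primary to a dual center the orientations cancel. This makes the skewed
gradients divergence-free and the gradients curl-free. -/
lemma sum_nSign_mul_tSign (hΩ : IsOpen Ω) (i : Fin nc) (ν : Fin nv) :
    ∑ e ∈ M.EC i ∩ M.EV ν, M.nSign e i * M.tSign e ν = 0 := by
  rcases (M.EC i ∩ M.EV ν).eq_empty_or_nonempty with h | ⟨e, he⟩
  · rw [h, Finset.sum_empty]
  rw [Finset.mem_inter, mem_EC, mem_EV] at he
  obtain ⟨hi, hν⟩ := he
  obtain ⟨e', hne, hi', hν'⟩ := M.exists_adjacent hΩ hi hν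
  rw [M.EC_inter_EV_eq hne.symm hi hi' hν hν', Finset.sum_pair hne.symm,
    M.sign_opposite hne.symm hi hi' hν hν', add_neg_cancel]

/-! ### The discrete operators -/

lemma grad_apply (φ : M.PrimaryField) (e : Fin ne) :
    M.grad φ e = (-1 / M.d e) * ∑ i ∈ M.CE e, φ i * M.nSign e i := rfl

lemma skewGrad_apply (ψ : M.DualField) (e : Fin ne) :
    M.skewGrad ψ e = (1 / M.l e) * ∑ ν ∈ M.VE e, ψ ν * M.tSign e ν := rfl

lemma div_apply (u : M.VectorField) (i : Fin nc) :
    M.div u i = (1 / M.cellArea i) * ∑ e ∈ M.EC i, u e * M.l e * M.nSign e i := rfl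

lemma curl_apply (u : M.VectorField) (ν : Fin nv) :
    M.curl u ν = (-1 / M.dualCellArea ν) * ∑ e ∈ M.EV ν, u e * M.d e * M.tSign e ν := rfl

lemma div_skewGrad (hΩ : IsOpen Ω) (ψ : M.DualField) : M.div (M.skewGrad ψ) = 0 := by
  ext i
  rw [div_apply, Pi.zero_apply]
  refine mul_eq_zero_of_right _ ?_
  have h1 : ∀ e ∈ M.EC i, M.skewGrad ψ e * M.l e * M.nSign e i
      = ∑ ν ∈ M.VE e, ψ ν * (M.nSign e i * M.tSign e ν) := by
    intro e _
    have := (M.l_pos e).ne'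
    rw [skewGrad_apply, one_div_mul_eq_div, div_mul_cancel₀ _ this, Finset.sum_mul]
    exact Finset.sum_congr rfl fun ν _ => by ring
  rw [Finset.sum_congr rfl h1, Finset.sum_comm' (t' := Finset.univ)
    (s' := fun ν => M.EC i ∩ M.EV ν) (by intro e ν; simp [mem_EC, mem_EV])]
  refine Finset.sum_eq_zero fun ν _ => ?_
  rw [← Finset.mul_sum, M.sum_nSign_mul_tSign hΩ, mul_zero]

lemma curl_grad (hΩ : IsOpen Ω) (φ : M.PrimaryField) : M.curl (M.grad φ) = 0 := by
  ext ν
  rw [curl_apply, Pi.zero_apply]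
  refine mul_eq_zero_of_right _ ?_
  have h1 : ∀ e ∈ M.EV ν, M.grad φ e * M.d e * M.tSign e ν
      = ∑ i ∈ M.CE e, -φ i * (M.nSign e i * M.tSign e ν) := by
    intro e _
    have := (M.d_pos e).ne'
    rw [grad_apply, div_mul_eq_mul_div, div_mul_cancel₀ _ this, neg_one_mul, neg_mul,
      Finset.sum_mul, ← Finset.sum_neg_distrib]
    exact Finset.sum_congr rfl fun ν _ => by ring
  rw [Finset.sum_congr rfl h1, Finset.sum_comm' (t' := Finset.univ)
    (s' := fun i => M.EC i ∩ M.EV ν) (by intro e ν; simp [mem_EC, mem_EV, and_comm])]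
  refine Finset.sum_eq_zero fun i _ => ?_
  rw [← Finset.mul_sum, M.sum_nSign_mul_tSign hΩ, mul_zero]

/-- Up to a constant, the skewed gradient is minus the adjoint of the curl. -/
lemma innerV_skewGrad (hbdd : Bornology.IsBounded Ω) (ψ : M.DualField) (v : M.VectorField) :
    M.innerV (M.skewGrad ψ) v = -stdArea * ∑ ν, M.dualCellArea ν * ψ ν * M.curl v ν := by
  have h1 : ∀ e, M.diamondArea e * M.skewGrad ψ e * v e
      = ∑ ν ∈ M.VE e, stdArea * (ψ ν * (v e * M.d e * M.tSign e ν)) := by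
    intro e
    have := (M.l_pos e).ne'
    rw [skewGrad_apply, diamondArea_eq, ← Finset.mul_sum,
      Finset.sum_congr rfl fun ν _ => (by ring :
        ψ ν * (v e * M.d e * M.tSign e ν) = (v e * M.d e) * (ψ ν * M.tSign e ν)),
      ← Finset.mul_sum]
    field_simp
  have h2 : ∀ ν, M.dualCellArea ν * ψ ν * M.curl v ν
      = -∑ e ∈ M.EV ν, ψ ν * (v e * M.d e * M.tSign e ν) := by
    intro ν
    have := (M.dualCellArea_pos hbdd ν).ne'
    rw [curl_apply, ← Finset.mul_sum]
    field_simp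
  rw [innerV, Finset.sum_congr rfl fun e _ => h1 e, Finset.sum_congr rfl fun ν _ => h2 ν,
    Finset.sum_neg_distrib, neg_mul_neg, Finset.mul_sum,
    Finset.sum_comm' (t' := Finset.univ) (s' := fun ν => M.EV ν)
      (by intro e ν; simp [mem_EV])]
  exact Finset.sum_congr rfl fun ν _ => (Finset.mul_sum _ _ _).symm

/-- Up to a constant, the gradient is minus the adjoint of the divergence. -/
lemma innerV_grad (hbdd : Bornology.IsBounded Ω) (φ : M.PrimaryField) (u : M.VectorField) :
    M.innerV u (M.grad φ) = -stdArea * ∑ i, M.cellArea i * φ i * M.div u i := by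
  have h1 : ∀ e, M.diamondArea e * u e * M.grad φ e
      = ∑ i ∈ M.CE e, -stdArea * (φ i * (u e * M.l e * M.nSign e i)) := by
    intro e
    have := (M.d_pos e).ne'
    rw [grad_apply, diamondArea_eq, ← Finset.mul_sum,
      Finset.sum_congr rfl fun i _ => (by ring :
        φ i * (u e * M.l e * M.nSign e i) = (u e * M.l e) * (φ i * M.nSign e i)),
      ← Finset.mul_sum]
    field_simp
  have h2 : ∀ i, M.cellArea i * φ i * M.div u i
      = ∑ e ∈ M.EC i, φ i * (u e * M.l e * M.nSign e i) := by
    intro i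
    have := (M.cellArea_pos hbdd i).ne'
    rw [div_apply, ← Finset.mul_sum]
    field_simp
  rw [innerV, Finset.sum_congr rfl fun e _ => h1 e, Finset.sum_congr rfl fun i _ => h2 i,
    Finset.mul_sum, Finset.sum_comm' (t' := Finset.univ) (s' := fun i => M.EC i)
      (by intro e i; simp [mem_EC])]
  exact Finset.sum_congr rfl fun ν _ => (Finset.mul_sum _ _ _).symm

lemma eq_zero_of_innerV_self {u : M.VectorField} (h : M.innerV u u = 0) : u = 0 := by
  have hnn : ∀ e ∈ Finset.univ, 0 ≤ M.diamondArea e * u e * u e := fun e _ => by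
    rw [mul_assoc]; exact mul_nonneg (M.diamondArea_pos e).le (mul_self_nonneg _)
  ext e
  have := (Finset.sum_eq_zero_iff_of_nonneg hnn).1 h e (Finset.mem_univ e)
  rw [mul_assoc] at this
  simpa [(M.diamondArea_pos e).ne'] using this

lemma grad_eq {e : Fin ne} {i j : Fin nc} (hi : i ∈ M.CE e) (hj : j ∈ M.CE e) (hij : j ≠ i)
    (φ : M.PrimaryField) : M.grad φ e = -(M.nSign e i / M.d e) * (φ i - φ j) := by
  have hCE : M.CE e = {i, j} := by
    obtain ⟨k, hk, hki, hCE, -⟩ := M.exists_opposite_x hi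
    rw [hCE, Finset.mem_insert, Finset.mem_singleton] at hj
    rw [hCE, hj.resolve_left hij]
  rw [grad_apply, hCE, Finset.sum_pair hij.symm, M.nSign_opposite hi hj hij]
  ring

/-- Two scalar fields with the same gradient at an edge differ by a constant at this edge. -/
lemma sub_eq_sub_of_grad_eq {e : Fin ne} {φ φ' : M.PrimaryField} (h : M.grad φ e = M.grad φ' e)
    {i j : Fin nc} (hi : i ∈ M.CE e) (hj : j ∈ M.CE e) : φ i - φ' i = φ j - φ' j := by
  by_cases hij : j = i
  · rw [hij]
  rw [M.grad_eq hi hj hij, M.grad_eq hi hj hij] at h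
  have h0 : -(M.nSign e i / M.d e) ≠ 0 :=
    neg_ne_zero.2 (div_ne_zero (left_ne_zero_of_mul_eq_one (M.nSign_mul_self e i))
      (M.d_pos e).ne')
  linarith [mul_left_cancel₀ h0 h]

lemma grad_congr {e : Fin ne} {φ φ' : M.PrimaryField} (h : ∀ i ∈ M.CE e, φ i = φ' i) :
    M.grad φ e = M.grad φ' e := by
  rw [grad_apply, grad_apply, Finset.sum_congr rfl fun i hi => by rw [h i hi]]

lemma grad_const (c : ℝ) : M.grad (fun _ => c) = 0 := by
  ext e
  obtain ⟨i, hi⟩ := M.CE_nonempty e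
  obtain ⟨j, hj, hij, -⟩ := M.exists_opposite_x hi
  rw [M.grad_eq hi hj hij, sub_self, mul_zero, Pi.zero_apply]

lemma interior_diamond_subset (hreg : interior (closure Ω) = Ω) (e : Fin ne) :
    interior (M.diamond e) ⊆ Ω :=
  (interior_mono (M.diamond_subset e)).trans hreg.subset

/-- The gradient vanishes only on constants: `Ω` stays connected without the dual centers, and
diamonds that meet elsewhere in `Ω` share a primary center. -/
lemma eq_of_grad_eq_zero (hΩ : IsOpen Ω) (hconn : IsPreconnected Ω)
    (hreg : interior (closure Ω) = Ω) {φ : M.PrimaryField} (h : M.grad φ = 0) (i j : Fin nc) :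
    φ i = φ j := by
  have hloc {e : Fin ne} {i j : Fin nc} (hi : i ∈ M.CE e) (hj : j ∈ M.CE e) : φ i = φ j := by
    have := M.sub_eq_sub_of_grad_eq (φ := φ) (φ' := 0) (e := e) (by rw [h, map_zero]) hi hj
    simpa using this
  choose r hr using fun e => M.CE_nonempty e
  have hF : (Set.range M.y).Countable := Set.countable_range _
  have hmeet (e : Fin ne) : ((Ω \ Set.range M.y) ∩ M.diamond e).Nonempty := by
    obtain ⟨z, hz, hz'⟩ := isOpen_interior.nonempty_diff_countable
      (M.interior_diamond_nonempty e) hF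
    exact ⟨z, ⟨M.interior_diamond_subset hreg e hz, hz'⟩, interior_subset hz⟩
  obtain ⟨e, hi⟩ := M.exists_mem_CE i
  obtain ⟨e', hj⟩ := M.exists_mem_CE j
  have hcol := (IsPreconnected.diff_countable hΩ hconn hF).colour_eq M.diamond M.isClosed_diamond
    Set.univ (fun z hz => by
      obtain ⟨e, he⟩ := M.exists_mem_diamond (subset_closure hz.1)
      exact ⟨e, trivial, he⟩) (fun e => φ (r e))
    (fun e _ e' _ z hz he he' => by
      obtain ⟨k, hk, hk'⟩ := M.exists_common_x hΩ hz.1 he he' fun ν h => hz.2 ⟨ν, h.symm⟩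
      exact (hloc (hr e) hk).trans (hloc hk' (hr e')))
    (e := e) (e' := e') trivial trivial (hmeet e) (hmeet e')
  exact (hloc hi (hr e)).trans (hcol.trans (hloc (hr e') hj))

/-- There is a boundary edge. Otherwise, among the dual centers around a primary center that lies
farthest to the right, the one seen in the extreme direction would have a neighbour seen in a
direction beyond it. -/
lemma exists_card_VE_eq_one (hΩ : IsOpen Ω) (hne : Ω.Nonempty) : ∃ e, (M.VE e).card = 1 := by
  by_contra hcon
  push Not at hcon
  obtain ⟨z, hz⟩ := hne
  obtain ⟨e₀, -⟩ := M.exists_mem_diamond (subset_closure hz)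
  have : Nonempty (Fin nc) := ⟨(M.CE_nonempty e₀).choose⟩
  have : Nonempty (Fin nv) := ⟨(M.VE_nonempty e₀).choose⟩
  obtain ⟨i, hi⟩ := Finite.exists_max fun i => M.x i 0
  obtain ⟨ν₀, hν₀⟩ := Finite.exists_max fun ν => M.y ν 0
  have hlt : ∀ ν, M.y ν 0 < M.x i 0 := by
    intro ν
    by_contra hge
    push Not at hge
    set f : StrongDual ℝ Plane := EuclideanSpace.proj 0
    have hmax : ∀ p ∈ Ω, f p ≤ M.y ν₀ 0 := by
      intro p hp
      obtain ⟨e, he⟩ := M.exists_mem_diamond (subset_closure hp)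
      refine StrongDual.le_of_mem_convexHull ?_ p he
      rintro _ (⟨j, -, rfl⟩ | ⟨μ, -, rfl⟩)
      · exact (hi j).trans (hge.trans (hν₀ ν))
      · exact hν₀ μ
    have hf0 : f = 0 := StrongDual.eq_zero_of_isMax_interior (s := Ω) (z := M.y ν₀)
      (by rw [hΩ.interior_eq]; exact M.y_mem ν₀) hmax rfl
    have : f !₂[1, 0] = 0 := by rw [hf0]; rfl
    simp [f] at this
  let T : Finset (Fin nv) := Finset.univ.filter fun ν => ∃ e, i ∈ M.CE e ∧ ν ∈ M.VE e
  have hT : T.Nonempty := by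
    obtain ⟨e, he⟩ := M.exists_mem_CE i
    obtain ⟨ν, hν⟩ := M.VE_nonempty e
    exact ⟨ν, by simp only [T, Finset.mem_filter, Finset.mem_univ, true_and]; exact ⟨e, he, hν⟩⟩
  obtain ⟨ν, hνT, hmax⟩ := T.exists_max_image
    (fun ν => (M.y ν 1 - M.x i 1) / (M.x i 0 - M.y ν 0)) hT
  simp only [T, Finset.mem_filter, Finset.mem_univ, true_and] at hνT hmax
  -- the diamond beyond the side from `x i` to `y ν`
  obtain ⟨e, hie, hνe, hD⟩ : ∃ e, i ∈ M.CE e ∧ ν ∈ M.VE e ∧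
      planeDet (M.x i - M.cross e) (M.y ν - M.cross e) < 0 := by
    obtain ⟨e, he, hν⟩ := hνT
    obtain ⟨e', hne, he', hν'⟩ := M.exists_adjacent hΩ he hν
    rcases mul_neg_iff.1 (M.planeDet_mul_planeDet_neg hne he' he hν' hν) with ⟨-, h⟩ | ⟨h, -⟩
    exacts [⟨e, he, hν, h⟩, ⟨e', he', hν', h⟩]
  obtain ⟨μ, hμ, -, -, -, τ, hτ, h⟩ := M.exists_opposite_y hνe (hcon e)
  have hle := hmax μ ⟨e, hie, hμ⟩
  have hν0 := sub_pos.2 (hlt ν)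
  have hμ0 := sub_pos.2 (hlt μ)
  rw [div_le_div_iff₀ hμ0 hν0] at hle
  have hdet : (M.y ν 0 - M.x i 0) * (M.y μ 1 - M.x i 1) - (M.y ν 1 - M.x i 1) * (M.y μ 0 - M.x i 0)
      = (1 + τ) * planeDet (M.x i - M.cross e) (M.y ν - M.cross e) := by
    have h0 := congrArg (fun v : Plane => v 0) h
    have h1 := congrArg (fun v : Plane => v 1) h
    simp only [PiLp.sub_apply, PiLp.neg_apply, PiLp.smul_apply, smul_eq_mul] at h0 h1
    simp only [planeDet, PiLp.sub_apply]
    linear_combination (M.y ν 0 - M.x i 0) * h1 - (M.y ν 1 - M.x i 1) * h0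
  nlinarith

lemma eq_of_skewGrad_apply_eq_zero {ψ : M.DualField} {e : Fin ne} (h : M.skewGrad ψ e = 0) {ν μ : Fin nv}
    (hν : ν ∈ M.VE e) (hμ : μ ∈ M.VE e) : ψ ν = ψ μ := by
  by_cases hμν : μ = ν
  · rw [hμν]
  have hVE : M.VE e = {ν, μ} := by
    obtain ⟨k, hk, -, hVE, -⟩ := M.exists_opposite_y hν
      fun h => hμν (M.eq_of_mem_VE_of_card_eq_one h hν hμ)
    rw [hVE, Finset.mem_insert, Finset.mem_singleton] at hμ
    rw [hVE, hμ.resolve_left hμν]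
  rw [skewGrad_apply, hVE, Finset.sum_pair (Ne.symm hμν), M.tSign_opposite hν hμ hμν] at h
  have h1 := (mul_eq_zero.1 h).resolve_left (one_div_ne_zero (M.l_pos e).ne')
  have h2 : (ψ ν - ψ μ) * M.tSign e ν = 0 := by linarith
  exact sub_eq_zero.1 ((mul_eq_zero.1 h2).resolve_right
    (left_ne_zero_of_mul_eq_one (M.tSign_mul_self e ν)))

/-- The skewed gradient is injective: `Ω` stays connected without the primary centers, diamonds
that meet elsewhere in `Ω` share a dual center, and at a boundary edge the field vanishes. -/
lemma eq_zero_of_skewGrad_eq_zero (hΩ : IsOpen Ω) (hconn : IsConnected Ω)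
    (hreg : interior (closure Ω) = Ω) {ψ : M.DualField} (h : M.skewGrad ψ = 0) : ψ = 0 := by
  have hloc {e : Fin ne} {ν μ : Fin nv} (hν : ν ∈ M.VE e) (hμ : μ ∈ M.VE e) : ψ ν = ψ μ :=
    M.eq_of_skewGrad_apply_eq_zero (congrFun h e) hν hμ
  choose r hr using fun e => M.VE_nonempty e
  have hF : (Set.range M.x).Countable := Set.countable_range _
  have hmeet (e : Fin ne) : ((Ω \ Set.range M.x) ∩ M.diamond e).Nonempty := by
    obtain ⟨z, hz, hz'⟩ := isOpen_interior.nonempty_diff_countable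
      (M.interior_diamond_nonempty e) hF
    exact ⟨z, ⟨M.interior_diamond_subset hreg e hz, hz'⟩, interior_subset hz⟩
  obtain ⟨e', hb⟩ := M.exists_card_VE_eq_one hΩ hconn.nonempty
  have h0 : ψ (r e') = 0 := by
    have hVE : M.VE e' = {r e'} := by
      obtain ⟨μ, hμ⟩ := Finset.card_eq_one.1 hb
      have := hr e'
      rw [hμ, Finset.mem_singleton] at this
      rw [hμ, this]
    have h1 := congrFun h e'
    rw [skewGrad_apply, hVE, Finset.sum_singleton] at h1
    have h2 := (mul_eq_zero.1 h1).resolve_left (one_div_ne_zero (M.l_pos e').ne')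
    exact (mul_eq_zero.1 h2).resolve_right
      (left_ne_zero_of_mul_eq_one (M.tSign_mul_self e' _))
  ext ν
  obtain ⟨e, hν⟩ := M.exists_mem_VE ν
  have hcol := (IsPreconnected.diff_countable hΩ hconn.isPreconnected hF).colour_eq M.diamond
    M.isClosed_diamond Set.univ (fun z hz => by
      obtain ⟨e, he⟩ := M.exists_mem_diamond (subset_closure hz.1)
      exact ⟨e, trivial, he⟩) (fun e => ψ (r e))
    (fun e _ e' _ z hz he he' => by
      obtain ⟨k, hk, hk'⟩ := M.exists_common_y hΩ hz.1 he he' fun ν h => hz.2 ⟨ν, h.symm⟩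
      exact (hloc (hr e) hk).trans (hloc hk' (hr e')))
    (e := e) (e' := e') trivial trivial (hmeet e) (hmeet e')
  exact (hloc hν (hr e)).trans (hcol.trans h0)

/-! ### Connectedness of the stars of the centers -/

lemma x_ne_y {e : Fin ne} {i : Fin nc} (hi : i ∈ M.CE e) {ν : Fin nv} (hν : ν ∈ M.VE e) :
    M.x i ≠ M.y ν := by
  intro h
  have := M.orthogonal e i hi ν hν
  rw [h] at this
  exact (real_inner_self_pos.2 (sub_ne_zero.2 (M.y_ne_cross e ν hν))).ne' this

/-- The diamonds around a dual center are connected through common primary centers, since a small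
circle around the dual center is connected. -/
lemma eq_of_mem_EV (hΩ : IsOpen Ω) {α : Type*} (s : Fin ne → α) (ν : Fin nv)
    (hs : ∀ e e', ν ∈ M.VE e → ν ∈ M.VE e' → ∀ i, i ∈ M.CE e → i ∈ M.CE e' → s e = s e')
    {e e' : Fin ne} (he : ν ∈ M.VE e) (he' : ν ∈ M.VE e') : s e = s e' := by
  -- a neighbourhood of the center without other centers and without diamonds away from the center
  let W : Set Plane := Ω ∩ ((⋃ e ∈ {e | M.y ν ∉ M.diamond e}, M.diamond e)
    ∪ ((Set.range M.x ∪ Set.range M.y) \ {M.y ν}))ᶜ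
  have hW : W ∈ nhds (M.y ν) := by
    refine (hΩ.inter (IsClosed.isOpen_compl (self := ?_))).mem_nhds ⟨M.y_mem ν, ?_⟩
    · refine IsClosed.union ?_ ?_
      · exact (Set.toFinite {e | M.y ν ∉ M.diamond e}).isClosed_biUnion
          fun e _ => M.isClosed_diamond e
      · exact (((Set.finite_range _).union (Set.finite_range _)).subset Set.sdiff_subset).isClosed
    · simp
  obtain ⟨r, hr, hrW⟩ := Metric.mem_nhds_iff.1 hW
  have hsub : Metric.sphere (M.y ν) (r / 2) ⊆ W := fun z hz => hrW (by
    rw [Metric.mem_sphere] at hz; rw [Metric.mem_ball, hz]; linarith)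
  have hmeet {e : Fin ne} (he : ν ∈ M.VE e) :
      (Metric.sphere (M.y ν) (r / 2) ∩ M.diamond e).Nonempty := by
    obtain ⟨i, hi⟩ := M.CE_nonempty e
    have hdist : r ≤ dist (M.x i) (M.y ν) := by
      by_contra h
      push Not at h
      exact (hrW (Metric.mem_ball.2 h)).2 (Or.inr ⟨Or.inl ⟨i, rfl⟩, M.x_ne_y hi he⟩)
    have hpos : 0 < dist (M.x i) (M.y ν) := hr.trans_le hdist
    set δ := r / 2 / dist (M.x i) (M.y ν) with hδ
    have hδ0 : 0 ≤ δ := by positivity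
    have hδ1 : δ ≤ 1 := by rw [hδ, div_le_one hpos]; linarith
    refine ⟨(1 - δ) • M.y ν + δ • M.x i, ?_, (M.convex_diamond e) (M.y_mem_diamond he)
      (M.x_mem_diamond hi) (sub_nonneg.2 hδ1) hδ0 (by ring)⟩
    have : (1 - δ) • M.y ν + δ • M.x i - M.y ν = δ • (M.x i - M.y ν) := by module
    rw [Metric.mem_sphere, dist_eq_norm, this, norm_smul, Real.norm_of_nonneg hδ0, ← dist_eq_norm,
      hδ, div_mul_cancel₀ _ hpos.ne']
  refine (isPreconnected_sphere one_lt_rank_plane (M.y ν) (r / 2)).colour_eq M.diamond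
    M.isClosed_diamond {e | ν ∈ M.VE e} ?_ s ?_ he he' (hmeet he) (hmeet he')
  · intro z hz
    obtain ⟨a, ha⟩ := M.exists_mem_diamond (subset_closure (hsub hz).1)
    refine ⟨a, M.mem_VE_of_y_mem he ?_, ha⟩
    by_contra hcon
    exact (hsub hz).2 (Or.inl (Set.mem_biUnion (x := a) hcon ha))
  · intro a ha b hb z hz hza hzb
    obtain ⟨i, hi, hi'⟩ := M.exists_common_x hΩ (hsub hz).1 hza hzb fun μ hμ => by
      refine (hsub hz).2 (Or.inr ⟨Or.inr ⟨μ, hμ.symm⟩, ?_⟩)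
      rintro rfl
      rw [Metric.mem_sphere, dist_self] at hz
      linarith
    exact hs a b ha hb i hi hi'

/-- The diamonds around a primary center are connected through common dual centers, since the
primary cell has connected interior. -/
lemma eq_of_mem_EC (hΩ : IsOpen Ω) (hreg : interior (closure Ω) = Ω) {α : Type*} (s : Fin ne → α)
    (i : Fin nc)
    (hs : ∀ e e', i ∈ M.CE e → i ∈ M.CE e' → ∀ ν, ν ∈ M.VE e → ν ∈ M.VE e' → s e = s e')
    {e e' : Fin ne} (he : i ∈ M.CE e) (he' : i ∈ M.CE e') : s e = s e' := by
  set C := interior (⋃ e, ⋃ _ : i ∈ M.CE e,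
    convexHull ℝ (insert (M.x i) (insert (M.cross e) (M.y '' M.VE e)))) with hC
  have hsubD {e : Fin ne} (he : i ∈ M.CE e) :
      convexHull ℝ (insert (M.x i) (insert (M.cross e) (M.y '' M.VE e))) ⊆ M.diamond e := by
    refine convexHull_min (Set.insert_subset (M.x_mem_diamond he)
      (Set.insert_subset (M.cross_mem_diamond e) ?_)) (M.convex_diamond e)
    rintro _ ⟨ν, hν, rfl⟩
    exact M.y_mem_diamond hν
  have hCΩ : C ⊆ Ω := by
    rw [← hreg]
    exact interior_mono (Set.iUnion₂_subset fun e he => (hsubD he).trans (M.diamond_subset e))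
  have hF : (Set.range M.x).Countable := Set.countable_range _
  have hmeet {e : Fin ne} (he : i ∈ M.CE e) : ((C \ Set.range M.x) ∩ M.diamond e).Nonempty := by
    obtain ⟨ν, hν⟩ := M.VE_nonempty e
    obtain ⟨z, hz, hz'⟩ := isOpen_interior.nonempty_diff_countable
      (interior_triangle_nonempty (M.planeDet_cross_ne_zero he hν)) hF
    refine ⟨z, ⟨interior_mono ?_ hz, hz'⟩, M.triangle_subset_diamond he hν (interior_subset hz)⟩
    refine (convexHull_mono ?_).trans (Set.subset_iUnion₂_of_subset e he subset_rfl)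
    rintro p (rfl | rfl | rfl)
    exacts [Or.inr (Or.inl rfl), Or.inl rfl, Or.inr (Or.inr ⟨ν, hν, rfl⟩)]
  refine (IsPreconnected.diff_countable isOpen_interior (M.cell_connected i).isPreconnected
    hF).colour_eq M.diamond M.isClosed_diamond {e | i ∈ M.CE e} ?_ s ?_ he he' (hmeet he)
    (hmeet he')
  · intro z hz
    obtain ⟨a, ha, hza⟩ := Set.mem_iUnion₂.1 (interior_subset hz.1)
    exact ⟨a, ha, hsubD ha hza⟩
  · intro a ha b hb z hz hza hzb
    obtain ⟨ν, hν, hν'⟩ := M.exists_common_y hΩ (hCΩ hz.1) hza hzb fun j h => hz.2 ⟨j, h.symm⟩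
    exact hs a b ha hb ν hν hν'

/-! ### Potentials of curl-free fields -/

/-- A field that is curl-free at a dual center is a gradient around it. A linear functional that
vanishes on the gradients is, around the center, a multiple of the circulation, because the
diamonds around the center form one cycle. -/
lemma exists_localPotential (hΩ : IsOpen Ω) (hbdd : Bornology.IsBounded Ω) {u : M.VectorField}
    {ν : Fin nv} (hu : M.curl u ν = 0) :
    ∃ p : M.PrimaryField, ∀ e, ν ∈ M.VE e → M.grad p e = u e := by
  classical
  let mask : (Fin ne → ℝ) →ₗ[ℝ] (Fin ne → ℝ) :=
    LinearMap.pi fun e => if ν ∈ M.VE e then LinearMap.proj e else 0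
  have hmask (v : Fin ne → ℝ) (e : Fin ne) : mask v e = if ν ∈ M.VE e then v e else 0 := by
    simp only [mask, LinearMap.pi_apply]; split_ifs <;> rfl
  by_cases hmem : mask u ∈ LinearMap.range (mask ∘ₗ M.grad)
  · obtain ⟨p, hp⟩ := hmem
    refine ⟨p, fun e he => ?_⟩
    have := congrFun hp e
    rwa [LinearMap.comp_apply, hmask, hmask, if_pos he, if_pos he] at this
  exfalso
  obtain ⟨f, hfu, hf⟩ := Submodule.exists_le_ker_of_notMem hmem
  set w : Fin ne → ℝ := fun e => f (fun j => if e = j then 1 else 0)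
  have hfsum (v : Fin ne → ℝ) : f (mask v) = ∑ e ∈ M.EV ν, v e * w e := by
    rw [LinearMap.pi_apply_eq_sum_univ f, EV, Finset.sum_filter]
    refine Finset.sum_congr rfl fun e _ => ?_
    rw [hmask]; split_ifs <;> simp [w]
  have hgrad (k : Fin nc) : ∑ e ∈ M.EC k ∩ M.EV ν, M.nSign e k * (w e / M.d e) = 0 := by
    have h0 : f (mask (M.grad (Pi.single k 1))) = 0 := hf ⟨Pi.single k 1, rfl⟩
    rw [hfsum] at h0
    have hterm : ∀ e ∈ M.EV ν, M.grad (Pi.single k 1) e * w e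
        = if e ∈ M.EC k then -(M.nSign e k * (w e / M.d e)) else 0 := by
      intro e _
      rw [grad_apply]
      simp only [Pi.single_apply, ite_mul, one_mul, zero_mul, Finset.sum_ite_eq', mem_EC]
      split_ifs <;> ring
    rw [Finset.sum_congr rfl hterm, Finset.sum_ite_mem, Finset.sum_neg_distrib, neg_eq_zero,
      Finset.inter_comm] at h0
    exact h0
  have hconst {e e' : Fin ne} (he : ν ∈ M.VE e) (he' : ν ∈ M.VE e') :
      w e * M.tSign e ν / M.d e = w e' * M.tSign e' ν / M.d e' := by
    refine M.eq_of_mem_EV hΩ (fun e => w e * M.tSign e ν / M.d e) ν ?_ he he'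
    intro a b ha hb k hka hkb
    by_cases hab : a = b
    · rw [hab]
    -- `a` and `b` are the only diamonds of this star at `k`, and their signs are opposite
    have h1 := hgrad k
    rw [M.EC_inter_EV_eq hab hka hkb ha hb, Finset.sum_pair hab] at h1
    have h2 := M.sign_opposite hab hka hkb ha hb
    have ta := M.tSign_mul_self a ν
    have tb := M.tSign_mul_self b ν
    have na := M.nSign_mul_self a k
    linear_combination (M.nSign a k * M.tSign a ν * M.tSign b ν) *
        (M.tSign b ν * h1 - w b / M.d b * h2)
      - w a / M.d a * M.tSign a ν * (M.tSign b ν ^ 2 * na + tb)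
      + w b / M.d b * M.tSign b ν * (M.tSign a ν ^ 2 * na + ta)
  obtain ⟨e₀, he₀⟩ := M.exists_mem_VE ν
  apply hfu
  rw [hfsum]
  have hterm : ∀ e ∈ M.EV ν, u e * w e
      = w e₀ * M.tSign e₀ ν / M.d e₀ * (u e * M.d e * M.tSign e ν) := by
    intro e he
    rw [← hconst (M.mem_EV.1 he) he₀]
    have hd := (M.d_pos e).ne'
    have ht := M.tSign_mul_self e ν
    field_simp
    linear_combination (-(u e * w e)) * ht
  rw [Finset.sum_congr rfl hterm, ← Finset.mul_sum]
  rw [curl_apply] at hu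
  rw [(mul_eq_zero.1 hu).resolve_left (div_ne_zero (by norm_num)
    (M.dualCellArea_pos hbdd ν).ne'), mul_zero]

/-- `M.IsStar a e` means that the center `a`, primary or dual, is a vertex of the diamond `e`. -/
def IsStar : Fin nc ⊕ Fin nv → Fin ne → Prop :=
  Sum.elim (fun i e => i ∈ M.CE e) fun ν e => ν ∈ M.VE e

/-- The set of the points of `Ω` all of whose diamonds have the vertex `a`: the open star of
`a`. -/
def openStar (a : Fin nc ⊕ Fin nv) : Set Ω := {z | ∀ e, (z : Plane) ∈ M.diamond e → M.IsStar a e}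

lemma eventually_diamond_subset (z : Ω) :
    ∀ᶠ w : Ω in nhds z, ∀ e, (w : Plane) ∈ M.diamond e → (z : Plane) ∈ M.diamond e := by
  rw [Filter.eventually_all]
  intro e
  by_cases hz : (z : Plane) ∈ M.diamond e
  · exact Filter.Eventually.of_forall fun w _ => hz
  · have := (M.isClosed_diamond e).isOpen_compl.preimage (continuous_subtype_val (p := (· ∈ Ω)))
    filter_upwards [this.mem_nhds hz] with w hw hwe
    exact absurd hwe hw

lemma isOpen_openStar (a : Fin nc ⊕ Fin nv) : IsOpen (M.openStar a) := by
  rw [isOpen_iff_mem_nhds]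
  intro z hz
  filter_upwards [M.eventually_diamond_subset z] with w hw e he
  exact hz e (hw e he)

lemma y_mem_openStar (ν : Fin nv) : (⟨M.y ν, M.y_mem ν⟩ : Ω) ∈ M.openStar (Sum.inr ν) := by
  obtain ⟨e, he⟩ := M.exists_mem_VE ν
  exact fun e' he' => M.mem_VE_of_y_mem he he'

/-- The potential of the field `u` on the star of the center `a`, as a function of the diamond in
the star and of the primary center. Around a dual center `ν` it is the local potential `p ν`;
around a primary center `k` it is normalized to vanish at `k`. -/
def starPotential (u : M.VectorField) (p : Fin nv → M.PrimaryField) :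
    Fin nc ⊕ Fin nv → Fin ne → M.PrimaryField :=
  Sum.elim (fun k e i => if i = k then 0 else -(M.d e * u e * M.nSign e i)) fun ν _ => p ν

lemma grad_starPotential {u : M.VectorField} {p : Fin nv → M.PrimaryField}
    (hp : ∀ ν e, ν ∈ M.VE e → M.grad (p ν) e = u e) {a : Fin nc ⊕ Fin nv} {e : Fin ne}
    (ha : M.IsStar a e) : M.grad (M.starPotential u p a e) e = u e := by
  rcases a with k | ν
  · obtain ⟨j, hj, hjk, -⟩ := M.exists_opposite_x (i := k) (e := e) ha
    rw [M.grad_eq ha hj hjk]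
    simp only [starPotential, Sum.elim_inl, if_true, if_neg hjk]
    rw [M.nSign_opposite ha hj hjk]
    have hd := (M.d_pos e).ne'
    have hn := M.nSign_mul_self e k
    field_simp
    linear_combination u e * M.d e * hn
  · exact hp ν e ha

/-- At a point of `Ω`, the potentials on two stars differ by a constant. -/
lemma starPotential_sub (hΩ : IsOpen Ω) {u : M.VectorField} {p : Fin nv → M.PrimaryField}
    (hp : ∀ ν e, ν ∈ M.VE e → M.grad (p ν) e = u e) {a b : Fin nc ⊕ Fin nv} {z : Ω}
    (ha : z ∈ M.openStar a) (hb : z ∈ M.openStar b) {e e' : Fin ne}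
    (he : (z : Plane) ∈ M.diamond e) (he' : (z : Plane) ∈ M.diamond e') {i i' : Fin nc}
    (hi : i ∈ M.CE e) (hi' : i' ∈ M.CE e') :
    M.starPotential u p a e i - M.starPotential u p b e i
      = M.starPotential u p a e' i' - M.starPotential u p b e' i' := by
  have hsub {e : Fin ne} (he : (z : Plane) ∈ M.diamond e) {i j : Fin nc} (hi : i ∈ M.CE e)
      (hj : j ∈ M.CE e) : M.starPotential u p a e i - M.starPotential u p b e i
        = M.starPotential u p a e j - M.starPotential u p b e j :=
    M.sub_eq_sub_of_grad_eq (by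
      rw [M.grad_starPotential hp (ha e he), M.grad_starPotential hp (hb e he)]) hi hj
  by_cases hee : e = e'
  · subst hee; exact hsub he hi hi'
  rcases a with k | ν <;> rcases b with k' | ν'
  · by_cases hk : k = k'
    · subst hk; simp
    · exact absurd (M.eq_of_common_x hΩ z.2 he he' hk (ha e he) (ha e' he') (hb e he) (hb e' he'))
        hee
  · rw [hsub he hi (ha e he), hsub he' hi' (ha e' he')]
    simp [starPotential]
  · rw [hsub he hi (hb e he), hsub he' hi' (hb e' he')]
    simp [starPotential]
  · by_cases hk : ν = ν'
    · subst hk; simp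
    · exact absurd (M.eq_of_common_y hk (ha e he) (ha e' he') (hb e he) (hb e' he')) hee

/-- A function that is locally constant on the open star of a dual center takes the same value at
the center and in the interiors of the diamonds around it. -/
lemma eq_of_locallyConst_openStar (hreg : interior (closure Ω) = Ω) {ν : Fin nv} {e : Fin ne}
    (he : ν ∈ M.VE e) (c : Ω → ℝ)
    (hc : ∀ z ∈ M.openStar (Sum.inr ν), ∀ᶠ w in nhds z, c w = c z) {w : Ω}
    (hw : (w : Plane) ∈ interior (M.diamond e)) : c w = c ⟨M.y ν, M.y_mem ν⟩ := by
  have hpath (t : unitInterval) : (t : ℝ) = 0 ∨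
      M.y ν + (t : ℝ) • ((w : Plane) - M.y ν) ∈ interior (M.diamond e) := by
    rcases t.2.1.eq_or_lt with h | h
    · exact Or.inl h.symm
    · exact Or.inr ((M.convex_diamond e).add_smul_sub_mem_interior (M.y_mem_diamond he) hw
        ⟨h, t.2.2⟩)
  let γ : unitInterval → Ω := fun t => ⟨M.y ν + (t : ℝ) • ((w : Plane) - M.y ν), by
    rcases hpath t with h | h
    · rw [h, zero_smul, add_zero]; exact M.y_mem ν
    · exact M.interior_diamond_subset hreg e h⟩
  have hγ : Continuous γ := by
    refine Continuous.subtype_mk ?_ _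
    fun_prop
  have hγ0 : γ 0 = ⟨M.y ν, M.y_mem ν⟩ := Subtype.ext (by simp [γ])
  have hγ1 : γ 1 = w := Subtype.ext (by simp [γ])
  have hstar (t : unitInterval) : γ t ∈ M.openStar (Sum.inr ν) := by
    rcases hpath t with h | h
    · have : t = 0 := Subtype.ext h
      rw [this, hγ0]
      exact M.y_mem_openStar ν
    · intro e' he'
      rw [M.eq_of_mem_interior_diamond h he']
      exact he
  have hlc : IsLocallyConstant (c ∘ γ) := (IsLocallyConstant.iff_eventually_eq _).2 fun t =>
    hγ.continuousAt.eventually (hc _ (hstar t))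
  have := hlc.apply_eq_of_preconnectedSpace 1 0
  rwa [Function.comp_apply, Function.comp_apply, hγ0, hγ1] at this

/-- On a simply connected domain every curl-free field is a gradient. -/
lemma exists_grad_eq (hΩ : IsOpen Ω) (hbdd : Bornology.IsBounded Ω) (hsc : IsSimplyConnected Ω)
    (hreg : interior (closure Ω) = Ω) {u : M.VectorField} (hu : M.curl u = 0) :
    ∃ φ, M.grad φ = u := by
  have := hsc.simplyConnectedSpace
  have := hΩ.locallyPathConnectedSpace
  choose p hp using fun ν => M.exists_localPotential hΩ hbdd (congrFun hu ν)
  choose e₀ he₀ using fun z : Ω => M.exists_mem_diamond (subset_closure z.2)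
  choose i₀ hi₀ using M.CE_nonempty
  obtain ⟨F, hF⟩ := exists_sub_locallyConst_of_simplyConnected M.openStar M.isOpen_openStar
    (fun z => (M.exists_common_center hΩ z.2).elim (fun ⟨i, hi⟩ => ⟨Sum.inl i, hi⟩)
      fun ⟨ν, hν⟩ => ⟨Sum.inr ν, hν⟩)
    (fun a z => M.starPotential u p a (e₀ z) (i₀ (e₀ z))) (by
      rintro a b z ⟨ha, hb⟩
      filter_upwards [M.eventually_diamond_subset z] with w hw
      exact M.starPotential_sub hΩ hp ha hb (hw _ (he₀ w)) (he₀ z) (hi₀ _) (hi₀ _))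
  -- shift the local potentials so that they agree with `F`
  let c : Fin nv → ℝ := fun ν => F ⟨M.y ν, M.y_mem ν⟩ - p ν (i₀ (e₀ ⟨M.y ν, M.y_mem ν⟩))
  let q : Fin nv → M.PrimaryField := fun ν => p ν + fun _ => c ν
  have hq (ν : Fin nv) (e : Fin ne) (he : ν ∈ M.VE e) : M.grad (q ν) e = u e := by
    simp only [q]
    rw [map_add, M.grad_const, add_zero, hp ν e he]
  have hqF {ν : Fin nv} {e : Fin ne} (he : ν ∈ M.VE e) {w : Ω}
      (hw : (w : Plane) ∈ interior (M.diamond e)) : q ν (i₀ e) = F w := by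
    have h1 := M.eq_of_locallyConst_openStar hreg he
      (fun z => F z - p ν (i₀ (e₀ z))) (fun z hz => hF (Sum.inr ν) z hz) hw
    have h2 : e₀ w = e := M.eq_of_mem_interior_diamond hw (he₀ w)
    simp only [h2] at h1
    simp only [q, c, Pi.add_apply]
    linarith
  have hqq {ν μ : Fin nv} {e : Fin ne} (hν : ν ∈ M.VE e) (hμ : μ ∈ M.VE e) {i : Fin nc}
      (hi : i ∈ M.CE e) : q ν i = q μ i := by
    obtain ⟨w, hw⟩ := M.interior_diamond_nonempty e
    have hwΩ := M.interior_diamond_subset hreg e hw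
    have h1 := M.sub_eq_sub_of_grad_eq ((hq ν e hν).trans (hq μ e hμ).symm) hi (hi₀ e)
    rw [hqF hν (w := ⟨w, hwΩ⟩) hw, hqF hμ (w := ⟨w, hwΩ⟩) hw] at h1
    linarith
  choose r hr using M.VE_nonempty
  choose a ha using M.exists_mem_CE
  refine ⟨fun i => q (r (a i)) i, ?_⟩
  ext e
  rw [← hq _ e (hr e)]
  refine M.grad_congr fun i hi => ?_
  refine M.eq_of_mem_EC hΩ hreg (fun e => q (r e) i) i ?_ (ha i) hi
  intro e e' he he' ν hν hν'
  exact (hqq (hr e) hν he).trans (hqq hν' (hr e') he')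

end StaggeredMesh

end

theorem mainTheorem5 {Ω : Set Plane} (hopen : IsOpen Ω) (hbdd : Bornology.IsBounded Ω)
    (hsc : IsSimplyConnected Ω) (hreg : interior (closure Ω) = Ω)
    {nc nv ne : ℕ} (M : StaggeredMesh Ω nc nv ne) :
    -- `V_h` is the direct sum of the divergence-free and the curl-free fields
    IsCompl (LinearMap.ker M.div) (LinearMap.ker M.curl) ∧
    -- and the two summands are orthogonal
    (∀ u v : M.VectorField, M.div u = 0 → M.curl v = 0 → M.innerV u v = 0) ∧
    -- skewed gradients are divergence-free, gradients are curl-free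
    (∀ ψ : M.DualField, M.div (M.skewGrad ψ) = 0) ∧
    (∀ φ : M.PrimaryField, M.curl (M.grad φ) = 0) ∧
    -- unique representation, with `φ` of zero mean
    (∀ u : M.VectorField, ∃! p : M.DualField × M.PrimaryField,
      ∑ i, M.cellArea i * p.2 i = 0 ∧ u = M.skewGrad p.1 + M.grad p.2) := by
  have hconn : IsConnected Ω := hsc.isPathConnected.isConnected
  have horth : ∀ u v : M.VectorField, M.div u = 0 → M.curl v = 0 → M.innerV u v = 0 := by
    intro u v hu hv
    obtain ⟨φ, rfl⟩ := M.exists_grad_eq hopen hbdd hsc hreg hv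
    rw [M.innerV_grad hbdd, hu]
    simp
  have hinj : Function.Injective (M.curl ∘ₗ M.skewGrad) := by
    rw [injective_iff_map_eq_zero]
    intro ψ hψ
    rw [LinearMap.comp_apply] at hψ
    apply M.eq_zero_of_skewGrad_eq_zero hopen hconn hreg
    apply M.eq_zero_of_innerV_self
    rw [M.innerV_skewGrad hbdd, hψ]
    simp
  have hdec : ∀ u : M.VectorField, ∃ ψ φ, u = M.skewGrad ψ + M.grad φ := by
    intro u
    obtain ⟨ψ, hψ⟩ := LinearMap.injective_iff_surjective.1 hinj (M.curl u)
    obtain ⟨φ, hφ⟩ := M.exists_grad_eq hopen hbdd hsc hreg (u := u - M.skewGrad ψ)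
      (by rw [map_sub, ← hψ, LinearMap.comp_apply, sub_self])
    exact ⟨ψ, φ, by rw [hφ]; abel⟩
  refine ⟨⟨?_, ?_⟩, horth, M.div_skewGrad hopen, M.curl_grad hopen, fun u => ?_⟩
  · rw [Submodule.disjoint_def]
    exact fun u hu hu' => M.eq_zero_of_innerV_self (horth u u hu hu')
  · rw [codisjoint_iff, eq_top_iff]
    intro u _
    obtain ⟨ψ, φ, rfl⟩ := hdec u
    exact Submodule.add_mem_sup (M.div_skewGrad hopen ψ) (M.curl_grad hopen φ)
  obtain ⟨ψ, φ, rfl⟩ := hdec u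
  obtain ⟨z, hz⟩ := hconn.nonempty
  obtain ⟨e, -⟩ := M.exists_mem_diamond (subset_closure hz)
  obtain ⟨k, -⟩ := M.CE_nonempty e
  have harea : 0 < ∑ i, M.cellArea i :=
    Finset.sum_pos (fun i _ => M.cellArea_pos hbdd i) ⟨k, Finset.mem_univ k⟩
  set m := (∑ i, M.cellArea i * φ i) / ∑ i, M.cellArea i with hm
  have hmean : ∑ i, M.cellArea i * (φ - fun _ => m : M.PrimaryField) i = 0 := by
    simp only [Pi.sub_apply, mul_sub, Finset.sum_sub_distrib, ← Finset.sum_mul]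
    rw [hm, mul_div_cancel₀ _ harea.ne', sub_self]
  have hgrad : M.grad (φ - fun _ => m) = M.grad φ := by rw [map_sub, M.grad_const, sub_zero]
  refine ⟨(ψ, φ - fun _ => m), ⟨hmean, by rw [hgrad]⟩, ?_⟩
  rintro ⟨ψ', φ'⟩ ⟨hmean', heq⟩
  set φ₀ : M.PrimaryField := φ - fun _ => m
  rw [← hgrad] at heq
  have h0 : M.skewGrad (ψ' - ψ) = M.grad (φ₀ - φ') := by
    rw [map_sub, map_sub, sub_eq_sub_iff_add_eq_add, add_comm (M.grad _), heq]
  have hs : M.skewGrad (ψ' - ψ) = 0 := M.eq_zero_of_innerV_self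
    (horth _ _ (M.div_skewGrad hopen _) (by rw [h0]; exact M.curl_grad hopen _))
  have hψ : ψ' = ψ := sub_eq_zero.1 (M.eq_zero_of_skewGrad_eq_zero hopen hconn hreg hs)
  rw [hs] at h0
  have hconst := M.eq_of_grad_eq_zero hopen hconn.isPreconnected hreg h0.symm
  have hk : (φ₀ - φ') k = 0 := by
    have h1 : ∑ i, M.cellArea i * (φ₀ - φ') i = 0 := by
      simp only [Pi.sub_apply φ₀, mul_sub, Finset.sum_sub_distrib]
      rw [hmean, hmean', sub_self]
    rw [Finset.sum_congr rfl fun i _ => by rw [hconst i k], ← Finset.sum_mul] at h1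
    exact (mul_eq_zero.1 h1).resolve_left harea.ne'
  have hφ : φ' = φ₀ := by
    ext i
    have := hconst i k
    rw [hk, Pi.sub_apply] at this
    linarith
  rw [hψ, hφ]
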